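/- Conventions. Let $A$ be a $C^*$-algebra with positive cone $A_+$. A weight on $A$ is a map $\omega: A_+\to[0,\infty]$ with $\omega(a+b)=\omega(a)+\omega(b)$ and $\omega(ra)=r\,\omega(a)$ for $a,b\in A_+$, $r\ge 0$ (where $0\cdot\infty=0$), which is non-zero, lower semi-continuous and densely defined, i.e. $\{a\in A_+:\omega(a)<\infty\}$ is dense in $A_+$. A trace on $A$ is a weight $\tau$ with $\tau(a^*a)=\tau(aa^*)$ for all $a\in A$. A flow $\theta=(\theta_t)_{t\in\mathbb R}$ on $A$ is a strongly continuous one-parameter group of automorphisms. For $z\in\mathbb C$, $D(\theta_z)$ is the set of $a\in A$ for which there is a function $f$ with values in $A$, continuous on the closed strip of all $w$ with $\operatorname{Im} w$ between $0$ and $\operatorname{Im} z$ and holomorphic in its interior, such that $f(t)=\theta_t(a)$ for all $t\in\mathbb R$; then $\theta_z(a)=f(z)$. For $\beta\in\mathbb R$, a $\beta$-KMS weight for $\theta$ is a weight $\omega$ on $A$ such that $\omega\circ\theta_t=\omega$ for all $t\in\mathbb R$ and $$\omega(a^*a)=\omega\big(\theta_{-\frac{i\beta}{2}}(a)\,\theta_{-\frac{i\beta}{2}}(a)^*\big)\qquad\text{for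 all } a\in D(\theta_{-\frac{i\beta}{2}}).$$ Lemma. Let $B$ be a separable $C^*$-algebra and $\gamma$ an automorphism of $B$. Let $B\rtimes_\gamma\mathbb Z$ be the crossed product, the completion in its universal $C^*$-norm of the $*$-algebra of finite sums $\sum_n b_nu^n$ ($b_n\in B$) with $(au^n)(bu^m)=a\gamma^n(b)u^{n+m}$ and $(bu^n)^*=\gamma^{-n}(b^*)u^{-n}$, and identify $b \in B$ with $bu^0$. Let $\widehat\gamma$ be the dual action on $B\rtimes_\gamma\mathbb Z$, considered as the $2\pi$-periodic flow with $\widehat\gamma_t(bu^n)=e^{int}bu^n$, and let $P:B\rtimes_\gamma\mathbb Z\to B$ be the canonical conditional expectation, i.e. the continuous linear map with $P(b)=b$ and $P(bu^n)=0$ for $b\in B$, $n\neq0$. Then for every $\beta\in\mathbb R$ the restriction map $\omega\mapsto\omega|_B$ is a bijection from the set of $\beta$-KMS weights for $\widehat\gamma$ onto the set of traces $\tau$ on $B$ with $\tau\circ\gamma=e^{-\beta}\tau$. Its inverse is the map $\tau\mapsto\tau\circ P$. -/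

import Mathlib

/-- The algebra `C_c(ℤ, B)` of finitely supported functions `ℤ → B`, with the convolution product
and involution twisted by the automorphism `γ`.  The element `single n b` is `b uⁿ`. -/
def TwistedCc {B : Type*} [NonUnitalCStarAlgebra B] (_γ : B ≃⋆ₐ[ℂ] B) : Type _ := ℤ →₀ B

namespace TwistedCc

variable {B : Type*} [NonUnitalCStarAlgebra B] {γ : B ≃⋆ₐ[ℂ] B}

noncomputable instance : AddCommGroup (TwistedCc γ) := inferInstanceAs (AddCommGroup (ℤ →₀ B))
noncomputable instance : Module ℂ (TwistedCc γ) := inferInstanceAs (Module ℂ (ℤ →₀ B))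

/-- The element `b uⁿ`, i.e. the function supported at `n` with value `b`. -/
noncomputable def single (n : ℤ) (b : B) : TwistedCc γ := Finsupp.single n b

/-- The value of `f : ℤ → B` at `n`. -/
def coeff (f : TwistedCc γ) (n : ℤ) : B := Finsupp.toFun f n

@[simp] lemma single_zero (n : ℤ) : (single n 0 : TwistedCc γ) = 0 := Finsupp.single_zero n

lemma single_add (n : ℤ) (a b : B) : (single n (a + b) : TwistedCc γ) = single n a + single n b :=
  Finsupp.single_add n a b

lemma smul_single (c : ℂ) (n : ℤ) (b : B) : c • (single n b : TwistedCc γ) = single n (c • b) :=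
  Finsupp.smul_single c n b

lemma coeff_add (f g : TwistedCc γ) (n : ℤ) : (f + g).coeff n = f.coeff n + g.coeff n := rfl

lemma coeff_smul (c : ℂ) (f : TwistedCc γ) (n : ℤ) : (c • f).coeff n = c • f.coeff n := rfl

lemma coeff_single (n m : ℤ) (b : B) :
    (single n b : TwistedCc γ).coeff m = if n = m then b else 0 := Finsupp.single_apply

@[elab_as_elim]
lemma induction_single {p : TwistedCc γ → Prop} (f : TwistedCc γ) (zero : p 0)
    (add : ∀ f g, p f → p g → p (f + g)) (single : ∀ n b, p (single n b)) : p f :=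
  Finsupp.induction_linear f zero add single

/-- The additive map on `C_c(ℤ, B)` given on each `b uⁿ` by `F n b`. -/
noncomputable def lift {M : Type*} [AddCommMonoid M] (F : ℤ → B →+ M) : TwistedCc γ →+ M :=
  (Finsupp.liftAddHom F : (ℤ →₀ B) →+ M)

@[simp] lemma lift_single {M : Type*} [AddCommMonoid M] (F : ℤ → B →+ M) (n : ℤ) (b : B) :
    lift F (single n b : TwistedCc γ) = F n b := Finsupp.liftAddHom_apply_single F n b

/-- `single n` as an additive map. -/
noncomputable def singleHom (n : ℤ) : B →+ TwistedCc γ :=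
  { toFun := single n, map_zero' := single_zero n, map_add' := single_add n }

@[simp] lemma singleHom_apply (n : ℤ) (b : B) : (singleHom n b : TwistedCc γ) = single n b := rfl

/-- The twisted convolution as a biadditive map, determined by
`(a uⁿ)(b uᵐ) = a γⁿ(b) uⁿ⁺ᵐ`. -/
noncomputable def mulHom : TwistedCc γ →+ TwistedCc γ →+ TwistedCc γ :=
  lift fun n => AddMonoidHom.mk'
    (fun a => lift fun m => (singleHom (n + m)).comp
      ((AddMonoidHom.mulLeft a).comp ((γ ^ n : B ≃⋆ₐ[ℂ] B) : B →+ B)))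
    (fun a a' => by
      ext f
      induction f using induction_single with
      | zero => simp
      | add f g hf hg => simp only [map_add, hf, hg]
      | single m b => simp [add_mul, single_add])

/-- The involution as an additive map, determined by `(b uⁿ)* = γ⁻ⁿ(b*) u⁻ⁿ`. -/
noncomputable def starHom : TwistedCc γ →+ TwistedCc γ :=
  lift fun n => (singleHom (-n)).comp
    (((γ ^ (-n) : B ≃⋆ₐ[ℂ] B) : B →+ B).comp (starAddEquiv : B ≃+ B).toAddMonoidHom)

noncomputable instance : Mul (TwistedCc γ) := ⟨fun f g => mulHom f g⟩

noncomputable instance : Star (TwistedCc γ) := ⟨fun f => starHom f⟩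

@[simp] lemma single_mul_single (n m : ℤ) (a b : B) :
    (single n a * single m b : TwistedCc γ) = single (n + m) (a * (γ ^ n) b) := by
  change mulHom (single n a) (single m b) = _
  simp [mulHom]

@[simp] lemma star_single (n : ℤ) (b : B) :
    star (single n b : TwistedCc γ) = single (-n) ((γ ^ (-n)) (star b)) := by
  change starHom (single n b) = _
  simp [starHom]

protected lemma mul_add (f g h : TwistedCc γ) : f * (g + h) = f * g + f * h :=
  map_add (mulHom f) g h

protected lemma add_mul (f g h : TwistedCc γ) : (f + g) * h = f * h + g * h := by
  change mulHom (f + g) h = mulHom f h + mulHom g h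
  simp

protected lemma star_add (f g : TwistedCc γ) : star (f + g) = star f + star g :=
  map_add starHom f g

protected lemma zero_mul (f : TwistedCc γ) : 0 * f = 0 := by
  change mulHom 0 f = 0
  simp

protected lemma mul_zero (f : TwistedCc γ) : f * 0 = 0 := map_zero (mulHom f)

protected lemma star_zero : star (0 : TwistedCc γ) = 0 := map_zero starHom

lemma zpow_apply_zpow (m n : ℤ) (b : B) : (γ ^ m) ((γ ^ n) b) = (γ ^ (m + n)) b := by
  rw [zpow_add]; rfl

protected lemma mul_assoc (f g h : TwistedCc γ) : f * g * h = f * (g * h) := by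
  refine induction_single f ?_ ?_ ?_
  · simp [TwistedCc.zero_mul]
  · intro a b ha hb; simp only [TwistedCc.add_mul, ha, hb]
  intro n a
  refine induction_single g ?_ ?_ ?_
  · simp [TwistedCc.zero_mul, TwistedCc.mul_zero]
  · intro _ _ ha hb; simp only [TwistedCc.add_mul, TwistedCc.mul_add, ha, hb]
  intro m b
  refine induction_single h ?_ ?_ ?_
  · simp [TwistedCc.mul_zero]
  · intro _ _ ha hb; simp only [TwistedCc.mul_add, ha, hb]
  intro k c
  simp [zpow_apply_zpow, mul_assoc, add_assoc]

noncomputable instance : NonUnitalRing (TwistedCc γ) where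
  left_distrib := TwistedCc.mul_add
  right_distrib := TwistedCc.add_mul
  zero_mul := TwistedCc.zero_mul
  mul_zero := TwistedCc.mul_zero
  mul_assoc := TwistedCc.mul_assoc

noncomputable instance : StarRing (TwistedCc γ) where
  star_involutive f := by
    refine induction_single f ?_ ?_ ?_
    · simp [TwistedCc.star_zero]
    · intro _ _ ha hb; simp only [TwistedCc.star_add, ha, hb]
    · intro n b
      simp only [star_single, ← map_star, star_star, zpow_apply_zpow]
      simp
  star_add := TwistedCc.star_add
  star_mul f g := by
    refine induction_single f ?_ ?_ ?_
    · simp [TwistedCc.star_zero]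
    · intro _ _ ha hb; simp only [TwistedCc.star_add, add_mul, mul_add, ha, hb]
    intro n a
    refine induction_single g ?_ ?_ ?_
    · simp [TwistedCc.star_zero]
    · intro _ _ ha hb; simp only [TwistedCc.star_add, add_mul, mul_add, ha, hb]
    intro m b
    simp only [single_mul_single, star_single, star_mul, map_mul, ← map_star, zpow_apply_zpow]
    congr 1
    · ring
    · congr 2 <;> ring_nf

instance : IsScalarTower ℂ (TwistedCc γ) (TwistedCc γ) where
  smul_assoc c f g := by
    simp only [smul_eq_mul]
    refine induction_single f ?_ ?_ ?_
    · simp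
    · intro _ _ ha hb; simp only [smul_add, add_mul, ha, hb]
    intro n a
    refine induction_single g ?_ ?_ ?_
    · simp
    · intro _ _ ha hb; simp only [smul_add, mul_add, ha, hb]
    intro m b
    simp [smul_single, smul_mul_assoc]

instance : SMulCommClass ℂ (TwistedCc γ) (TwistedCc γ) where
  smul_comm c f g := by
    simp only [smul_eq_mul]
    refine induction_single f ?_ ?_ ?_
    · simp
    · intro _ _ ha hb; simp only [smul_add, add_mul, ha, hb]
    intro n a
    refine induction_single g ?_ ?_ ?_
    · simp
    · intro _ _ ha hb; simp only [smul_add, mul_add, ha, hb]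
    intro m b
    simp [smul_single, mul_smul_comm]

instance : StarModule ℂ (TwistedCc γ) where
  star_smul c f := by
    refine induction_single f ?_ ?_ ?_
    · simp
    · intro _ _ ha hb; simp only [smul_add, star_add, ha, hb]
    intro n a
    simp [smul_single]

/-- The norm of `ℓ¹(ℤ, B)`. -/
noncomputable def l1Norm (f : TwistedCc γ) : ℝ := Finsupp.sum f fun _ b => ‖b‖

@[simp] lemma l1Norm_single (n : ℤ) (b : B) : l1Norm (single n b : TwistedCc γ) = ‖b‖ := by
  change Finsupp.sum (Finsupp.single n b) (fun _ b => ‖b‖) = _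
  rw [Finsupp.sum_single_index]; simp

lemma l1Norm_nonneg (f : TwistedCc γ) : 0 ≤ l1Norm f :=
  Finset.sum_nonneg fun _ _ => norm_nonneg _

/-- A seminorm that is dominated by `‖b‖` on every `b uⁿ` is dominated by the `ℓ¹`-norm. -/
lemma le_l1Norm (p : TwistedCc γ → ℝ) (h0 : p 0 ≤ 0) (hadd : ∀ f g, p (f + g) ≤ p f + p g)
    (hs : ∀ n b, p (single n b) ≤ ‖b‖) (f : TwistedCc γ) : p f ≤ l1Norm f := by
  classical
  refine Finsupp.induction (motive := fun f : ℤ →₀ B => p f ≤ l1Norm (γ := γ) f) f ?_ ?_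
  · exact h0.trans (l1Norm_nonneg _)
  · intro n b f hn hb ih
    have : l1Norm (γ := γ) (Finsupp.single n b + f : ℤ →₀ B) = ‖b‖ + l1Norm (γ := γ) f := by
      unfold l1Norm
      rw [Finsupp.sum_add_index_of_disjoint, Finsupp.sum_single_index (by simp)]
      refine Finset.disjoint_of_subset_left Finsupp.support_single_subset ?_
      simpa using hn
    rw [this]
    exact (hadd _ _).trans (add_le_add (hs n b) ih)


lemma zpow_norm (n : ℤ) (b : B) : ‖(γ ^ n) b‖ = ‖b‖ :=
  NonUnitalStarAlgHom.norm_map (γ ^ n) (EquivLike.injective (γ ^ n)) b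

end TwistedCc

/-- A C⋆-seminorm on `C_c(ℤ, B)` (dominated by the norm of `ℓ¹(ℤ, B)`).  These are the seminorms
`f ↦ ‖π f‖` where `π` is a ⋆-representation of `ℓ¹(ℤ, B)` on a Hilbert space. -/
structure CStarSeminorm {B : Type*} [NonUnitalCStarAlgebra B] (γ : B ≃⋆ₐ[ℂ] B) extends
    Seminorm ℂ (TwistedCc γ) where
  mul_le' : ∀ f g, toFun (f * g) ≤ toFun f * toFun g
  star_mul_self' : ∀ f, toFun (star f * f) = toFun f ^ 2
  le_l1Norm' : ∀ f, toFun f ≤ TwistedCc.l1Norm f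

section Regular

variable {B : Type*} [NonUnitalCStarAlgebra B] {γ : B ≃⋆ₐ[ℂ] B}

open TwistedCc

/-- `C_c(ℤ, B)` as a (pre-)Hilbert module over `B`, with `⟪x, y⟫ = ∑ₙ y(n) x(n)*`. -/
def RegModule (γ : B ≃⋆ₐ[ℂ] B) : Type _ := TwistedCc γ

namespace RegModule

noncomputable instance : AddCommGroup (RegModule γ) := inferInstanceAs (AddCommGroup (TwistedCc γ))
noncomputable instance : Module ℂ (RegModule γ) := inferInstanceAs (Module ℂ (TwistedCc γ))

noncomputable def of (f : TwistedCc γ) : RegModule γ := f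
noncomputable def out (f : RegModule γ) : TwistedCc γ := f

noncomputable instance : Inner B (RegModule γ) := ⟨fun x y => (y.out * star x.out).coeff 0⟩
noncomputable instance : SMul B (RegModule γ) := ⟨fun a x => of (single 0 a * x.out)⟩
noncomputable instance : Norm (RegModule γ) := CStarModule.norm B

end RegModule

namespace TwistedCc

@[simp] lemma coeff_zero (n : ℤ) : (0 : TwistedCc γ).coeff n = 0 := rfl

lemma coeff_mul_star (f g : TwistedCc γ) :
    (f * star g).coeff 0 = lift (fun n => AddMonoidHom.mulRight (star (g.coeff n))) f := by
  induction f using induction_single with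
  | zero => simp
  | add f f' hf hf' => simp only [add_mul, coeff_add, map_add, hf, hf']
  | single n a =>
    rw [lift_single]
    induction g using induction_single with
    | zero => simp
    | add g g' hg hg' =>
      simp only [star_add, mul_add, coeff_add, hg, hg', AddMonoidHom.coe_mulRight]
    | single m b =>
      by_cases h : m = n
      · subst h
        simp only [star_single, single_mul_single, zpow_apply_zpow]
        simp [coeff_single]
      · have : n + -m ≠ 0 := by omega
        simp [coeff_single, h, this]

lemma coeff_mul_single_mul_star (f g : TwistedCc γ) (c : B) :
    (f * single 0 c * star g).coeff 0 = lift (fun n =>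
      (AddMonoidHom.mulRight (star (g.coeff n))).comp (AddMonoidHom.mulRight ((γ ^ n) c))) f := by
  induction f using induction_single with
  | zero => simp
  | add f f' hf hf' => simp only [add_mul, coeff_add, map_add, hf, hf']
  | single n a =>
    rw [lift_single]
    induction g using induction_single with
    | zero => simp
    | add g g' hg hg' =>
      simp only [star_add, mul_add, coeff_add, hg, hg', AddMonoidHom.coe_mulRight,
        AddMonoidHom.comp_apply]
    | single m b =>
      by_cases h : m = n
      · subst h
        simp only [star_single, single_mul_single, zpow_apply_zpow]
        simp [coeff_single]
      · have : n + -m ≠ 0 := by omega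
        simp [coeff_single, h, this]

lemma star_coeff_zero (f : TwistedCc γ) : star (f.coeff 0) = (star f).coeff 0 := by
  induction f using induction_single with
  | zero => simp
  | add f f' hf hf' => simp only [coeff_add, star_add, hf, hf']
  | single n a =>
    by_cases h : n = 0
    · subst h; simp [coeff_single]
    · simp [coeff_single, h]

lemma coeff_single_zero_mul (a : B) (f : TwistedCc γ) (n : ℤ) :
    (single 0 a * f).coeff n = a * f.coeff n := by
  induction f using induction_single with
  | zero => simp
  | add f f' hf hf' => simp only [coeff_add, mul_add, hf, hf']
  | single m b =>
    by_cases h : m = n <;> simp [coeff_single, h]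

lemma coeff_mul_star_self (f : TwistedCc γ) :
    (f * star f).coeff 0 = Finsupp.sum f fun _ b => b * star b := by
  rw [coeff_mul_star]; rfl

section

variable [PartialOrder B] [StarOrderedRing B]

lemma coeff_mul_star_self_nonneg (f : TwistedCc γ) : 0 ≤ (f * star f).coeff 0 := by
  rw [coeff_mul_star_self]
  exact Finset.sum_nonneg fun _ _ => mul_star_self_nonneg _

noncomputable instance : CStarModule B (RegModule γ) where
  inner_add_right {x y z} := by
    change ((y.out + z.out) * star x.out).coeff 0 = _
    rw [add_mul, coeff_add]; rfl
  inner_self_nonneg {x} := coeff_mul_star_self_nonneg x.out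
  inner_self {x} := by
    change (x.out * star x.out).coeff 0 = 0 ↔ _
    rw [coeff_mul_star_self]
    constructor
    · intro h
      have h' := (Finset.sum_eq_zero_iff_of_nonneg
        (fun _ _ => mul_star_self_nonneg _)).1 h
      refine Finsupp.ext (M := B) fun n => ?_
      by_contra hn
      exact hn (CStarRing.mul_star_self_eq_zero_iff _ |>.1 (h' n (Finsupp.mem_support_iff.2 hn)))
    · rintro rfl
      exact Finsupp.sum_zero_index
  inner_op_smul_right {a x y} := by
    change (single 0 a * y.out * star x.out).coeff 0 = a * (y.out * star x.out).coeff 0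
    rw [mul_assoc, coeff_single_zero_mul]
  inner_smul_right_complex {z x y} := by
    change ((z • y.out) * star x.out).coeff 0 = z • (y.out * star x.out).coeff 0
    rw [smul_mul_assoc, coeff_smul]
  star_inner x y := by
    change star ((y.out * star x.out).coeff 0) = (x.out * star y.out).coeff 0
    rw [star_coeff_zero, star_mul, star_star]
  norm_eq_sqrt_norm_inner_self x := rfl


noncomputable instance : NormedAddCommGroup (RegModule γ) := CStarModule.normedAddCommGroup B
noncomputable instance : NormedSpace ℂ (RegModule γ) := .ofCore (CStarModule.normedSpaceCore B)

lemma RegModule.norm_of_sq (f : TwistedCc γ) :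
    ‖RegModule.of f‖ ^ 2 = ‖(f * star f).coeff 0‖ := CStarModule.norm_sq_eq B

lemma RegModule.norm_mul_single_le (g : TwistedCc γ) (n : ℤ) (b : B) :
    ‖RegModule.of (g * single n b)‖ ≤ ‖b‖ * ‖RegModule.of g‖ := by
  refine le_of_sq_le_sq ?_ (by positivity)
  rw [mul_pow, RegModule.norm_of_sq, RegModule.norm_of_sq]
  have h1 : g * single n b * star (g * single n b) = g * single 0 (b * star b) * star g := by
    rw [star_mul, ← mul_assoc, mul_assoc g, star_single, single_mul_single, zpow_apply_zpow]
    simp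
  have h2 : ‖b‖ ^ 2 * ‖(g * star g).coeff 0‖ = ‖(‖b‖ ^ 2 : ℝ) • (g * star g).coeff 0‖ := by
    rw [norm_smul]; simp
  rw [h1, h2]
  refine CStarAlgebra.norm_le_norm_of_nonneg_of_le ?_ ?_
  · rw [← h1]; exact coeff_mul_star_self_nonneg _
  · rw [coeff_mul_single_mul_star, coeff_mul_star_self]
    change Finsupp.sum g (fun n a => a * (γ ^ n) (b * star b) * star a) ≤ _
    unfold Finsupp.sum
    rw [Finset.smul_sum]
    refine Finset.sum_le_sum fun n _ => ?_
    have h3 := CStarAlgebra.star_right_conjugate_le_norm_smul (a := Finsupp.toFun g n)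
      (b := (γ ^ n) (b * star b)) (by rw [map_mul, map_star]; exact .mul_star_self _)
    rwa [zpow_norm, CStarRing.norm_self_mul_star, ← sq] at h3

lemma RegModule.norm_mul_le (g f : TwistedCc γ) :
    ‖RegModule.of (g * f)‖ ≤ l1Norm f * ‖RegModule.of g‖ := by
  rcases eq_or_ne ‖RegModule.of g‖ 0 with h | h
  · have : g = 0 := norm_eq_zero.1 h
    subst this
    rw [zero_mul, h]; simp
  · rw [← div_le_iff₀ (lt_of_le_of_ne (norm_nonneg _) h.symm)]
    refine le_l1Norm (fun f => ‖RegModule.of (g * f)‖ / ‖RegModule.of g‖) ?_ ?_ ?_ f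
    · rw [mul_zero]
      change ‖(0 : RegModule γ)‖ / _ ≤ 0
      simp
    · intro f f'
      rw [← add_div]
      gcongr
      rw [mul_add]
      exact norm_add_le (RegModule.of (g * f)) (RegModule.of (g * f'))
    · intro n b
      rw [div_le_iff₀ (lt_of_le_of_ne (norm_nonneg _) h.symm)]
      exact RegModule.norm_mul_single_le g n b

/-- Right multiplication by `f`, as a bounded operator on the Hilbert module. -/
noncomputable def rightReg (f : TwistedCc γ) : RegModule γ →L[ℂ] RegModule γ :=
  LinearMap.mkContinuous
    ({ toFun := fun g => RegModule.of (g.out * f)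
       map_add' := fun g g' => add_mul g.out g'.out f
       map_smul' := fun c g => smul_mul_assoc c g.out f } : RegModule γ →ₗ[ℂ] RegModule γ)
    (l1Norm f) fun g => RegModule.norm_mul_le g.out f

lemma norm_mul_le_rightReg (g f : TwistedCc γ) :
    ‖RegModule.of (g * f)‖ ≤ ‖rightReg f‖ * ‖RegModule.of g‖ :=
  (rightReg f).le_opNorm (RegModule.of g)

lemma norm_rightReg_mul_le (f g : TwistedCc γ) :
    ‖rightReg (f * g)‖ ≤ ‖rightReg f‖ * ‖rightReg g‖ := by
  have : rightReg (f * g) = (rightReg g).comp (rightReg f) := by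
    ext x
    exact (mul_assoc x.out f g).symm
  rw [this, mul_comm]
  exact ContinuousLinearMap.opNorm_comp_le _ _

lemma norm_rightReg_sq_le (f : TwistedCc γ) : ‖rightReg f‖ ^ 2 ≤ ‖rightReg (f * star f)‖ := by
  have h : ‖rightReg f‖ ≤ √‖rightReg (f * star f)‖ := by
    refine ContinuousLinearMap.opNorm_le_bound _ (Real.sqrt_nonneg _) fun g => ?_
    refine le_of_sq_le_sq ?_ (by positivity)
    rw [mul_pow, Real.sq_sqrt (norm_nonneg _)]
    change ‖RegModule.of (g.out * f)‖ ^ 2 ≤ _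
    rw [RegModule.norm_of_sq, star_mul, ← mul_assoc, mul_assoc g.out]
    have h1 := CStarModule.norm_inner_le (A := B) (RegModule γ) (x := g)
      (y := RegModule.of (g.out * (f * star f)))
    refine h1.trans ?_
    calc ‖g‖ * ‖RegModule.of (g.out * (f * star f))‖
        ≤ ‖g‖ * (‖rightReg (f * star f)‖ * ‖g‖) :=
          mul_le_mul_of_nonneg_left (norm_mul_le_rightReg _ _) (norm_nonneg _)
      _ = _ := by ring
  calc ‖rightReg f‖ ^ 2 ≤ √‖rightReg (f * star f)‖ ^ 2 := by gcongr
    _ = _ := Real.sq_sqrt (norm_nonneg _)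

lemma norm_rightReg_star (f : TwistedCc γ) : ‖rightReg (star f)‖ = ‖rightReg f‖ := by
  have key : ∀ f : TwistedCc γ, ‖rightReg f‖ ≤ ‖rightReg (star f)‖ := by
    intro f
    have h := (norm_rightReg_sq_le f).trans (norm_rightReg_mul_le f (star f))
    rw [sq] at h
    rcases eq_or_lt_of_le (norm_nonneg (rightReg f)) with h0 | h0
    · rw [← h0]; exact norm_nonneg _
    · exact le_of_mul_le_mul_left h h0
  refine le_antisymm ?_ (key f)
  simpa using key (star f)

/-- The regular C⋆-seminorm. -/
noncomputable def regSeminorm (γ : B ≃⋆ₐ[ℂ] B) : CStarSeminorm γ where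
  toFun f := ‖rightReg f‖
  map_zero' := by
    have : rightReg (0 : TwistedCc γ) = 0 := by ext x; exact mul_zero x.out
    rw [this, norm_zero]
  add_le' f g := by
    have : rightReg (f + g) = rightReg f + rightReg g := by ext x; exact mul_add x.out f g
    rw [this]; exact norm_add_le _ _
  neg' f := by
    have : rightReg (-f) = -rightReg f := by ext x; exact mul_neg x.out f
    rw [this, norm_neg]
  smul' c f := by
    have : rightReg (c • f) = c • rightReg f := by ext x; exact mul_smul_comm c x.out f
    rw [this, norm_smul]
  mul_le' := norm_rightReg_mul_le
  star_mul_self' f := by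
    refine le_antisymm ((norm_rightReg_mul_le _ _).trans ?_) ?_
    · rw [norm_rightReg_star, sq]
    · have := norm_rightReg_sq_le (star f)
      rwa [norm_rightReg_star, star_star] at this
  le_l1Norm' f := LinearMap.mkContinuous_norm_le _ (l1Norm_nonneg f) _

lemma norm_coeff_zero_le_of (f : TwistedCc γ) : ‖f.coeff 0‖ ≤ ‖RegModule.of f‖ := by
  refine le_of_sq_le_sq ?_ (norm_nonneg _)
  rw [RegModule.norm_of_sq, sq, ← CStarRing.norm_self_mul_star]
  refine CStarAlgebra.norm_le_norm_of_nonneg_of_le (mul_star_self_nonneg _) ?_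
  rw [coeff_mul_star_self]
  by_cases h : (0 : ℤ) ∈ Finsupp.support f
  · exact Finset.single_le_sum (f := fun n => Finsupp.toFun f n * star (Finsupp.toFun f n))
      (fun _ _ => mul_star_self_nonneg _) h
  · have : f.coeff 0 = 0 := Finsupp.notMem_support_iff.1 h
    rw [this, zero_mul]
    exact Finset.sum_nonneg fun _ _ => mul_star_self_nonneg _

lemma norm_coeff_zero_le_rightReg (f : TwistedCc γ) : ‖f.coeff 0‖ ≤ ‖rightReg f‖ := by
  rcases eq_or_lt_of_le (norm_nonneg (f.coeff 0)) with h0 | h0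
  · rw [← h0]; exact norm_nonneg _
  have h1 := (norm_coeff_zero_le_of (single 0 (star (f.coeff 0)) * f)).trans
    (norm_mul_le_rightReg _ f)
  have h2 : ‖RegModule.of (single 0 (star (f.coeff 0)) : TwistedCc γ)‖ = ‖f.coeff 0‖ := by
    rw [← sq_eq_sq₀ (norm_nonneg _) (norm_nonneg _), RegModule.norm_of_sq]
    simp [coeff_single, CStarRing.norm_star_mul_self, sq]
  rw [coeff_single_zero_mul, CStarRing.norm_star_mul_self, h2] at h1
  exact le_of_mul_le_mul_right h1 h0

end

lemma exists_norm_coeff_zero_le (γ : B ≃⋆ₐ[ℂ] B) :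
    ∃ p : CStarSeminorm γ, ∀ f : TwistedCc γ, ‖f.coeff 0‖ ≤ p.toFun f := by
  let _ := CStarAlgebra.spectralOrder B
  have := CStarAlgebra.spectralOrderedRing B
  exact ⟨regSeminorm γ, norm_coeff_zero_le_rightReg⟩

end TwistedCc

end Regular

namespace TwistedCc

variable {B : Type*} [NonUnitalCStarAlgebra B] {γ : B ≃⋆ₐ[ℂ] B}

instance : Nonempty (CStarSeminorm γ) := ⟨(exists_norm_coeff_zero_le γ).choose⟩

lemma bddAbove_cstarSeminorm (f : TwistedCc γ) :
    BddAbove (Set.range fun p : CStarSeminorm γ => p.toFun f) :=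
  ⟨l1Norm f, by rintro _ ⟨p, rfl⟩; exact p.le_l1Norm' f⟩

/-- The universal C⋆-norm on `C_c(ℤ, B)`: the supremum of all C⋆-seminorms. -/
noncomputable def universalNorm (f : TwistedCc γ) : ℝ := ⨆ p : CStarSeminorm γ, p.toFun f

lemma le_universalNorm (p : CStarSeminorm γ) (f : TwistedCc γ) : p.toFun f ≤ universalNorm f :=
  le_ciSup (bddAbove_cstarSeminorm f) p

lemma universalNorm_nonneg (f : TwistedCc γ) : 0 ≤ universalNorm f :=
  Real.iSup_nonneg fun p => apply_nonneg p.toSeminorm f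

lemma universalNorm_le_l1Norm (f : TwistedCc γ) : universalNorm f ≤ l1Norm f :=
  ciSup_le fun p => p.le_l1Norm' f

/-- The universal C⋆-norm as a seminorm. -/
noncomputable def universalSeminorm : Seminorm ℂ (TwistedCc γ) :=
  Seminorm.of universalNorm
    (fun f g => ciSup_le fun p => (p.add_le' f g).trans
      (add_le_add (le_universalNorm p f) (le_universalNorm p g)))
    (fun c f => by
      unfold universalNorm
      rw [Real.mul_iSup_of_nonneg (norm_nonneg c)]
      exact iSup_congr fun p => p.smul' c f)

lemma universalNorm_mul_le (f g : TwistedCc γ) :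
    universalNorm (f * g) ≤ universalNorm f * universalNorm g :=
  ciSup_le fun p => (p.mul_le' f g).trans
    (mul_le_mul (le_universalNorm p f) (le_universalNorm p g)
      (apply_nonneg p.toSeminorm g) (universalNorm_nonneg f))

lemma universalNorm_sq_le (f : TwistedCc γ) :
    universalNorm f ^ 2 ≤ universalNorm (star f * f) := by
  have h : universalNorm f ≤ √(universalNorm (star f * f)) := by
    refine ciSup_le fun p => Real.le_sqrt_of_sq_le ?_
    rw [← p.star_mul_self']
    exact le_universalNorm p _
  calc universalNorm f ^ 2 ≤ √(universalNorm (star f * f)) ^ 2 :=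
        pow_le_pow_left₀ (universalNorm_nonneg f) h 2
    _ = _ := Real.sq_sqrt (universalNorm_nonneg _)

lemma universalNorm_star (f : TwistedCc γ) : universalNorm (star f) = universalNorm f := by
  have key : ∀ f : TwistedCc γ, universalNorm f ≤ universalNorm (star f) := by
    intro f
    have h := (universalNorm_sq_le f).trans (universalNorm_mul_le (star f) f)
    rw [sq] at h
    rcases eq_or_lt_of_le (universalNorm_nonneg f) with h0 | h0
    · rw [← h0]; exact universalNorm_nonneg _
    · exact le_of_mul_le_mul_right h h0
  refine le_antisymm ?_ (key f)
  simpa using key (star f)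

noncomputable instance : SeminormedAddCommGroup (TwistedCc γ) :=
  universalSeminorm.toAddGroupSeminorm.toSeminormedAddCommGroup

lemma norm_def (f : TwistedCc γ) : ‖f‖ = universalNorm f := rfl

noncomputable instance : NonUnitalSeminormedRing (TwistedCc γ) where
  __ := (inferInstance : SeminormedAddCommGroup (TwistedCc γ))
  __ := (inferInstance : NonUnitalRing (TwistedCc γ))
  norm_mul_le := universalNorm_mul_le

noncomputable instance : NormedSpace ℂ (TwistedCc γ) where
  norm_smul_le c f := (map_smul_eq_mul universalSeminorm c f).le

instance : NormedStarGroup (TwistedCc γ) where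
  norm_star_le f := (universalNorm_star f).le

lemma norm_coeff_zero_le (f : TwistedCc γ) : ‖f.coeff 0‖ ≤ ‖f‖ := by
  obtain ⟨p, hp⟩ := exists_norm_coeff_zero_le γ
  exact (hp f).trans (le_universalNorm p f)

lemma norm_single_le (n : ℤ) (b : B) : ‖(single n b : TwistedCc γ)‖ ≤ ‖b‖ :=
  (universalNorm_le_l1Norm _).trans (l1Norm_single n b).le

end TwistedCc

/-- The (full) crossed product `B ⋊_γ ℤ`: the completion of `C_c(ℤ, B)` in its universal
C⋆-norm. -/
def CrossedProduct {B : Type*} [NonUnitalCStarAlgebra B] (γ : B ≃⋆ₐ[ℂ] B) : Type _ :=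
  UniformSpace.Completion (TwistedCc γ)

namespace CrossedProduct

variable {B : Type*} [NonUnitalCStarAlgebra B] {γ : B ≃⋆ₐ[ℂ] B}

open UniformSpace

noncomputable instance instNormedAddCommGroup : NormedAddCommGroup (CrossedProduct γ) :=
  inferInstanceAs (NormedAddCommGroup (Completion (TwistedCc γ)))
noncomputable instance instNormedSpace : NormedSpace ℂ (CrossedProduct γ) :=
  inferInstanceAs (NormedSpace ℂ (Completion (TwistedCc γ)))
instance : CompleteSpace (CrossedProduct γ) :=
  inferInstanceAs (CompleteSpace (Completion (TwistedCc γ)))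

/-- The canonical map from `C_c(ℤ, B)` to the crossed product. -/
noncomputable def of : TwistedCc γ →ₗᵢ[ℂ] CrossedProduct γ :=
  (Completion.toComplₗᵢ : TwistedCc γ →ₗᵢ[ℂ] Completion (TwistedCc γ))

lemma isUniformInducing_of : IsUniformInducing (of : TwistedCc γ → CrossedProduct γ) :=
  Completion.isUniformInducing_coe _

lemma denseRange_of : DenseRange (of : TwistedCc γ → CrossedProduct γ) :=
  Completion.denseRange_coe

lemma isDenseInducing_of : IsDenseInducing (of : TwistedCc γ → CrossedProduct γ) :=
  Completion.isDenseInducing_coe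

@[elab_as_elim]
lemma induction_of {p : CrossedProduct γ → Prop} (x : CrossedProduct γ)
    (hp : IsClosed {x | p x}) (ih : ∀ f : TwistedCc γ, p (of f)) : p x :=
  denseRange_of.induction_on x hp ih

/-- The product of the crossed product, as the extension of the product of `C_c(ℤ, B)`. -/
noncomputable def mulFun : CrossedProduct γ → CrossedProduct γ → CrossedProduct γ :=
  Function.curry ((isDenseInducing_of.prodMap isDenseInducing_of).extend
    (of ∘ Function.uncurry ((· * ·) : TwistedCc γ → TwistedCc γ → TwistedCc γ)))

noncomputable instance : Mul (CrossedProduct γ) := ⟨mulFun⟩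

lemma of_mul (f g : TwistedCc γ) : of (f * g) = of f * of g :=
  ((isDenseInducing_of.prodMap isDenseInducing_of).extend_eq
    (of.continuous.comp (continuous_mul (M := TwistedCc γ))) (f, g)).symm

instance : ContinuousMul (CrossedProduct γ) where
  continuous_mul := by
    let m : TwistedCc γ →+ TwistedCc γ →+ CrossedProduct γ :=
      AddMonoidHom.mul.compr₂ (of : TwistedCc γ →ₗᵢ[ℂ] CrossedProduct γ).toLinearMap.toAddMonoidHom
    have hm : Continuous fun p : TwistedCc γ × TwistedCc γ => m p.1 p.2 :=
      of.continuous.comp continuous_mul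
    have di : IsDenseInducing (Completion.toCompl : TwistedCc γ → Completion (TwistedCc γ)) :=
      Completion.isDenseInducing_coe
    exact di.extend_Z_bilin (G := CrossedProduct γ) di hm

/-- The involution of the crossed product, as the extension of the involution of `C_c(ℤ, B)`. -/
noncomputable def starFun : CrossedProduct γ → CrossedProduct γ :=
  isDenseInducing_of.extend fun f => of (star f)

noncomputable instance : Star (CrossedProduct γ) := ⟨starFun⟩

lemma of_star (f : TwistedCc γ) : of (star f) = star (of f) :=
  (isDenseInducing_of.extend_eq (of.continuous.comp continuous_star) f).symm

instance : ContinuousStar (CrossedProduct γ) where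
  continuous_star := (uniformContinuous_uniformly_extend isUniformInducing_of
    denseRange_of (of.isometry.uniformContinuous.comp
      (starₗᵢ ℂ : TwistedCc γ ≃ₗᵢ⋆[ℂ] TwistedCc γ).isometry.uniformContinuous)).continuous

attribute [irreducible] mulFun starFun instNormedAddCommGroup instNormedSpace

lemma of_add (f g : TwistedCc γ) : of (f + g) = of f + of g := map_add of f g

lemma of_smul (c : ℂ) (f : TwistedCc γ) : of (c • f) = c • of f := map_smul of c f

lemma of_zero : of (0 : TwistedCc γ) = 0 := map_zero of

lemma norm_of (f : TwistedCc γ) : ‖of f‖ = ‖f‖ := of.norm_map f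

protected lemma mul_add (x y z : CrossedProduct γ) : x * (y + z) = x * y + x * z := by
  induction x using induction_of with
  | hp => exact isClosed_eq (by fun_prop) (by fun_prop)
  | ih x =>
  induction y using induction_of with
  | hp => exact isClosed_eq (by fun_prop) (by fun_prop)
  | ih y =>
  induction z using induction_of with
  | hp => exact isClosed_eq (by fun_prop) (by fun_prop)
  | ih z => rw [← of_add, ← of_mul, ← of_mul, ← of_mul, ← of_add, mul_add]

protected lemma add_mul (x y z : CrossedProduct γ) : (x + y) * z = x * z + y * z := by
  induction x using induction_of with
  | hp => exact isClosed_eq (by fun_prop) (by fun_prop)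
  | ih x =>
  induction y using induction_of with
  | hp => exact isClosed_eq (by fun_prop) (by fun_prop)
  | ih y =>
  induction z using induction_of with
  | hp => exact isClosed_eq (by fun_prop) (by fun_prop)
  | ih z => rw [← of_add, ← of_mul, ← of_mul, ← of_mul, ← of_add, add_mul]

protected lemma mul_assoc (x y z : CrossedProduct γ) : x * y * z = x * (y * z) := by
  induction x using induction_of with
  | hp => exact isClosed_eq (by fun_prop) (by fun_prop)
  | ih x =>
  induction y using induction_of with
  | hp => exact isClosed_eq (by fun_prop) (by fun_prop)
  | ih y =>
  induction z using induction_of with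
  | hp => exact isClosed_eq (by fun_prop) (by fun_prop)
  | ih z => rw [← of_mul, ← of_mul, ← of_mul, ← of_mul, mul_assoc]

protected lemma smul_mul (c : ℂ) (x y : CrossedProduct γ) : c • x * y = c • (x * y) := by
    induction x using induction_of with
    | hp =>
      have h1 : Continuous fun x : CrossedProduct γ => c • x * y := by fun_prop
      have h2 : Continuous fun x : CrossedProduct γ => c • (x * y) := by fun_prop
      exact isClosed_eq h1 h2
    | ih x =>
    induction y using induction_of with
    | hp =>
      have h1 : Continuous fun y : CrossedProduct γ => c • of x * y := by fun_prop
      have h2 : Continuous fun y : CrossedProduct γ => c • (of x * y) := by fun_prop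
      exact isClosed_eq h1 h2
    | ih y => rw [← of_smul, ← of_mul, ← of_mul, ← of_smul, smul_mul_assoc]

protected lemma smul_mul' (c : ℂ) (x y : CrossedProduct γ) : c • (x * y) = x * c • y := by
    induction x using induction_of with
    | hp =>
      have h1 : Continuous fun x : CrossedProduct γ => c • (x * y) := by fun_prop
      have h2 : Continuous fun x : CrossedProduct γ => x * c • y := by fun_prop
      exact isClosed_eq h1 h2
    | ih x =>
    induction y using induction_of with
    | hp =>
      have h1 : Continuous fun y : CrossedProduct γ => c • (of x * y) := by fun_prop
      have h2 : Continuous fun y : CrossedProduct γ => of x * c • y := by fun_prop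
      exact isClosed_eq h1 h2
    | ih y => rw [← of_smul, ← of_mul, ← of_mul, ← of_smul, mul_smul_comm]

protected lemma star_smul (c : ℂ) (x : CrossedProduct γ) : star (c • x) = star c • star x := by
    induction x using induction_of with
    | hp =>
      have h1 : Continuous fun x : CrossedProduct γ => star (c • x) := by fun_prop
      have h2 : Continuous fun x : CrossedProduct γ => star c • star x := by fun_prop
      exact isClosed_eq h1 h2
    | ih x => rw [← of_smul, ← of_star, ← of_star, ← of_smul, star_smul]

noncomputable instance : NonUnitalRing (CrossedProduct γ) where
  __ := (inferInstance : AddCommGroup (CrossedProduct γ))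
  left_distrib := CrossedProduct.mul_add
  right_distrib := CrossedProduct.add_mul
  zero_mul x := by
    have h : (0 + 0) * x = 0 * x + 0 * x := CrossedProduct.add_mul 0 0 x
    rwa [add_zero, left_eq_add] at h
  mul_zero x := by
    have h : x * (0 + 0) = x * 0 + x * 0 := CrossedProduct.mul_add x 0 0
    rwa [add_zero, left_eq_add] at h
  mul_assoc := CrossedProduct.mul_assoc

noncomputable instance : NonUnitalNormedRing (CrossedProduct γ) where
  __ := (inferInstance : NormedAddCommGroup (CrossedProduct γ))
  __ := (inferInstance : NonUnitalRing (CrossedProduct γ))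
  norm_mul_le x y := by
    induction x using induction_of with
    | hp => exact isClosed_le (by fun_prop) (by fun_prop)
    | ih x =>
    induction y using induction_of with
    | hp => exact isClosed_le (by fun_prop) (by fun_prop)
    | ih y =>
      rw [← of_mul]
      simp only [norm_of]
      exact norm_mul_le x y

noncomputable instance : StarRing (CrossedProduct γ) where
  star_involutive x := by
    induction x using induction_of with
    | hp => exact isClosed_eq (by fun_prop) (by fun_prop)
    | ih x => rw [← of_star, ← of_star, star_star]
  star_mul x y := by
    induction x using induction_of with
    | hp => exact isClosed_eq (by fun_prop) (by fun_prop)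
    | ih x =>
    induction y using induction_of with
    | hp => exact isClosed_eq (by fun_prop) (by fun_prop)
    | ih y => simp only [← of_star, ← of_mul, star_mul]
  star_add x y := by
    induction x using induction_of with
    | hp => exact isClosed_eq (by fun_prop) (by fun_prop)
    | ih x =>
    induction y using induction_of with
    | hp => exact isClosed_eq (by fun_prop) (by fun_prop)
    | ih y => simp only [← of_star, ← of_add, star_add]

instance : CStarRing (CrossedProduct γ) where
  norm_mul_self_le x := by
    induction x using induction_of with
    | hp =>
      have h1 : Continuous fun x : CrossedProduct γ => ‖x‖ * ‖x‖ := by fun_prop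
      have h2 : Continuous fun x : CrossedProduct γ => ‖star x * x‖ := by fun_prop
      exact isClosed_le h1 h2
    | ih x =>
      rw [← of_star, ← of_mul, norm_of, norm_of, ← sq]
      exact TwistedCc.universalNorm_sq_le x

noncomputable instance : NonUnitalCStarAlgebra (CrossedProduct γ) where
  smul_assoc := CrossedProduct.smul_mul
  smul_comm := CrossedProduct.smul_mul'
  star_smul := CrossedProduct.star_smul

noncomputable instance : PartialOrder (CrossedProduct γ) := CStarAlgebra.spectralOrder _
instance : StarOrderedRing (CrossedProduct γ) := CStarAlgebra.spectralOrderedRing _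

/-- The canonical inclusion `B → B ⋊_γ ℤ`, `b ↦ b u⁰`. -/
noncomputable def embed (γ : B ≃⋆ₐ[ℂ] B) : B →⋆ₙₐ[ℂ] CrossedProduct γ where
  toFun b := of (TwistedCc.single 0 b)
  map_smul' c b := by
    change of (TwistedCc.single 0 (c • b)) = c • of (TwistedCc.single 0 b)
    rw [← of_smul, TwistedCc.smul_single]
  map_zero' := by rw [TwistedCc.single_zero, of_zero]
  map_add' a b := by rw [TwistedCc.single_add, of_add]
  map_mul' a b := by
    rw [← of_mul, TwistedCc.single_mul_single]
    simp
  map_star' a := by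
    rw [← of_star, TwistedCc.star_single]
    simp

lemma embed_apply (b : B) : embed γ b = of (TwistedCc.single 0 b) := rfl

/-- The evaluation `f ↦ f(0)` on `C_c(ℤ, B)`, which is contractive for the universal norm. -/
noncomputable def coeffZero (γ : B ≃⋆ₐ[ℂ] B) : TwistedCc γ →L[ℂ] B :=
  LinearMap.mkContinuous
    { toFun := fun f => f.coeff 0
      map_add' := fun f g => TwistedCc.coeff_add f g 0
      map_smul' := fun c f => TwistedCc.coeff_smul c f 0 }
    1 fun f => by
      rw [one_mul]
      exact TwistedCc.norm_coeff_zero_le f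

/-- The canonical conditional expectation `P : B ⋊_γ ℤ → B`, the continuous extension of
`f ↦ f(0)`; thus `P (b uⁿ) = 0` for `n ≠ 0` and `P b = b`. -/
noncomputable def expectation (γ : B ≃⋆ₐ[ℂ] B) : CrossedProduct γ →L[ℂ] B :=
  (coeffZero γ).extend (of (γ := γ)).toContinuousLinearMap

lemma expectation_of (f : TwistedCc γ) : expectation γ (of f) = f.coeff 0 :=
  (coeffZero γ).extend_eq (e := (of (γ := γ)).toContinuousLinearMap)
    denseRange_of isUniformInducing_of f

lemma expectation_embed (b : B) : expectation γ (embed γ b) = b := by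
  rw [embed_apply, expectation_of, TwistedCc.coeff_single, if_pos rfl]

lemma expectation_nonneg [PartialOrder B] [StarOrderedRing B] {x : CrossedProduct γ}
    (hx : 0 ≤ x) : 0 ≤ expectation γ x := by
  obtain ⟨y, rfl⟩ := CStarAlgebra.nonneg_iff_eq_star_mul_self.1 hx
  clear hx
  induction y using induction_of with
  | hp =>
    have h : Continuous fun y : CrossedProduct γ => expectation γ (star y * y) :=
      (expectation γ).continuous.comp (continuous_star.mul continuous_id)
    exact isClosed_le continuous_const h
  | ih f =>
    rw [← of_star, ← of_mul, expectation_of]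
    simpa using TwistedCc.coeff_mul_star_self_nonneg (star f)

end CrossedProduct

namespace TwistedCc

variable {B : Type*} [NonUnitalCStarAlgebra B] {γ : B ≃⋆ₐ[ℂ] B}

/-- The dual action on `C_c(ℤ, B)`: `b uⁿ ↦ e^{int} b uⁿ`. -/
noncomputable def dual (t : ℝ) : TwistedCc γ →+ TwistedCc γ :=
  lift fun n => (singleHom n).comp
    (DistribSMul.toAddMonoidHom B (Complex.exp (Complex.I * n * t)))

@[simp] lemma dual_single (t : ℝ) (n : ℤ) (b : B) :
    dual t (single n b : TwistedCc γ) = single n (Complex.exp (Complex.I * n * t) • b) := by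
  simp [dual]

lemma dual_zero_apply (f : TwistedCc γ) : dual 0 f = f := by
  induction f using induction_single with
  | zero => simp
  | add f g hf hg => rw [map_add, hf, hg]
  | single n b => simp

lemma dual_add_apply (s t : ℝ) (f : TwistedCc γ) : dual (s + t) f = dual s (dual t f) := by
  induction f using induction_single with
  | zero => simp
  | add f g hf hg => simp only [map_add, hf, hg]
  | single n b => simp [mul_add, Complex.exp_add, mul_smul]

lemma dual_smul (t : ℝ) (c : ℂ) (f : TwistedCc γ) : dual t (c • f) = c • dual t f := by
  induction f using induction_single with
  | zero => simp
  | add f g hf hg => simp only [map_add, smul_add, hf, hg]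
  | single n b => simp only [dual_single, smul_single, smul_comm c]

lemma dual_mul (t : ℝ) (f g : TwistedCc γ) : dual t (f * g) = dual t f * dual t g := by
  induction f using induction_single with
  | zero => simp
  | add f f' hf hf' => simp only [map_add, add_mul, hf, hf']
  | single n a =>
    induction g using induction_single with
    | zero => simp
    | add g g' hg hg' => simp only [map_add, mul_add, hg, hg']
    | single m b =>
      simp only [dual_single, single_mul_single, map_smul, smul_mul_assoc, mul_smul_comm, smul_smul,
        ← Complex.exp_add]
      push_cast
      ring_nf

lemma dual_star (t : ℝ) (f : TwistedCc γ) : dual t (star f) = star (dual t f) := by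
  induction f using induction_single with
  | zero => simp
  | add f f' hf hf' => simp only [map_add, star_add, hf, hf']
  | single n a =>
    simp only [dual_single, star_single, star_smul, map_smul]
    congr 2
    change _ = starRingEnd ℂ _
    rw [← Complex.exp_conj]
    simp

lemma universalNorm_dual_le (t : ℝ) (f : TwistedCc γ) :
    universalNorm (dual t f) ≤ universalNorm f := by
  refine ciSup_le fun p => ?_
  let q : CStarSeminorm γ :=
    { toFun := fun f => p.toFun (dual t f)
      map_zero' := by rw [map_zero]; exact p.map_zero'
      add_le' := fun f g => by rw [map_add]; exact p.add_le' _ _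
      neg' := fun f => by rw [map_neg]; exact p.neg' _
      smul' := fun c f => by rw [dual_smul]; exact p.smul' _ _
      mul_le' := fun f g => by rw [dual_mul]; exact p.mul_le' _ _
      star_mul_self' := fun f => by rw [dual_mul, dual_star]; exact p.star_mul_self' _
      le_l1Norm' := le_l1Norm (fun f => p.toFun (dual t f))
        (by rw [map_zero]; exact p.map_zero'.le)
        (fun f g => by rw [map_add]; exact p.add_le' _ _)
        (fun n b => by
          rw [dual_single]
          refine (p.le_l1Norm' _).trans ?_
          rw [l1Norm_single, norm_smul, Complex.norm_exp]
          simp) }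
  exact le_universalNorm q f

lemma norm_dual (t : ℝ) (f : TwistedCc γ) : ‖dual t f‖ = ‖f‖ := by
  refine le_antisymm (universalNorm_dual_le t f) ?_
  have h := universalNorm_dual_le (-t) (dual t f)
  rwa [← dual_add_apply, neg_add_cancel, dual_zero_apply] at h

/-- The dual action on `C_c(ℤ, B)` as a linear isometry. -/
noncomputable def dualLI (t : ℝ) : TwistedCc γ →ₗᵢ[ℂ] TwistedCc γ where
  toFun := dual t
  map_add' := map_add (dual t)
  map_smul' := dual_smul t
  norm_map' := norm_dual t

end TwistedCc

/-- A flow on a C⋆-algebra: a strongly continuous one-parameter group of automorphisms. -/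
structure CStarFlow (A : Type*) [NonUnitalCStarAlgebra A] where
  /-- The automorphism at time `t`. -/
  aut : ℝ → (A ≃⋆ₐ[ℂ] A)
  aut_zero : aut 0 = 1
  aut_add : ∀ s t, aut (s + t) = aut s * aut t
  continuous_aut : ∀ a, Continuous fun t => aut t a

namespace CrossedProduct

variable {B : Type*} [NonUnitalCStarAlgebra B] {γ : B ≃⋆ₐ[ℂ] B}

/-- The extension of the dual action to the crossed product, as a continuous linear map. -/
noncomputable def dualL (γ : B ≃⋆ₐ[ℂ] B) (t : ℝ) : CrossedProduct γ →L[ℂ] CrossedProduct γ :=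
  ((of (γ := γ)).toContinuousLinearMap.comp
    (TwistedCc.dualLI t).toContinuousLinearMap).extend (of (γ := γ)).toContinuousLinearMap

lemma dualL_of (t : ℝ) (f : TwistedCc γ) : dualL γ t (of f) = of (TwistedCc.dual t f) :=
  ContinuousLinearMap.extend_eq _ (e := (of (γ := γ)).toContinuousLinearMap)
    denseRange_of isUniformInducing_of f

lemma dualL_zero (x : CrossedProduct γ) : dualL γ 0 x = x := by
  induction x using induction_of with
  | hp => exact isClosed_eq (dualL γ 0).continuous continuous_id
  | ih f => rw [dualL_of, TwistedCc.dual_zero_apply]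

lemma dualL_add (s t : ℝ) (x : CrossedProduct γ) :
    dualL γ (s + t) x = dualL γ s (dualL γ t x) := by
  induction x using induction_of with
  | hp =>
    exact isClosed_eq (dualL γ _).continuous
      ((dualL γ s).continuous.comp (dualL γ t).continuous)
  | ih f => rw [dualL_of, dualL_of, dualL_of, TwistedCc.dual_add_apply]

lemma norm_dualL (t : ℝ) (x : CrossedProduct γ) : ‖dualL γ t x‖ = ‖x‖ := by
  induction x using induction_of with
  | hp => exact isClosed_eq (dualL γ t).continuous.norm continuous_norm
  | ih f => rw [dualL_of, norm_of, norm_of, TwistedCc.norm_dual]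

/-- The extension of the dual action to the crossed product, as a ⋆-homomorphism. -/
noncomputable def dualHom (γ : B ≃⋆ₐ[ℂ] B) (t : ℝ) :
    CrossedProduct γ →⋆ₙₐ[ℂ] CrossedProduct γ where
  toFun := dualL γ t
  map_smul' c x := map_smul (dualL γ t) c x
  map_zero' := map_zero (dualL γ t)
  map_add' x y := map_add (dualL γ t) x y
  map_mul' x y := by
    induction x using induction_of with
    | hp =>
      have h1 : Continuous fun x => dualL γ t (x * y) :=
        (dualL γ t).continuous.comp (continuous_id.mul continuous_const)
      have h2 : Continuous fun x => dualL γ t x * dualL γ t y :=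
        (dualL γ t).continuous.mul continuous_const
      exact isClosed_eq h1 h2
    | ih f =>
    induction y using induction_of with
    | hp =>
      have h1 : Continuous fun y => dualL γ t (of f * y) :=
        (dualL γ t).continuous.comp (continuous_const.mul continuous_id)
      have h2 : Continuous fun y => dualL γ t (of f) * dualL γ t y :=
        continuous_const.mul (dualL γ t).continuous
      exact isClosed_eq h1 h2
    | ih g => rw [← of_mul, dualL_of, dualL_of, dualL_of, TwistedCc.dual_mul, of_mul]
  map_star' x := by
    induction x using induction_of with
    | hp =>
      have h1 : Continuous fun x => dualL γ t (star x) := (dualL γ t).continuous.comp continuous_star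
      have h2 : Continuous fun x => star (dualL γ t x) := continuous_star.comp (dualL γ t).continuous
      exact isClosed_eq h1 h2
    | ih f => rw [← of_star, dualL_of, dualL_of, TwistedCc.dual_star, of_star]

lemma dualHom_apply (t : ℝ) (x : CrossedProduct γ) : dualHom γ t x = dualL γ t x := rfl

/-- The automorphism of the crossed product determined by `b uⁿ ↦ e^{int} b uⁿ`. -/
noncomputable def dualAut (γ : B ≃⋆ₐ[ℂ] B) (t : ℝ) : CrossedProduct γ ≃⋆ₐ[ℂ] CrossedProduct γ :=
  { toFun := dualL γ t
    invFun := dualL γ (-t)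
    left_inv := fun x => by rw [← dualL_add, neg_add_cancel, dualL_zero]
    right_inv := fun x => by rw [← dualL_add, add_neg_cancel, dualL_zero]
    map_mul' := map_mul (dualHom γ t)
    map_add' := map_add (dualHom γ t)
    map_star' := map_star (dualHom γ t)
    map_smul' := map_smul (dualHom γ t) }

lemma dualAut_apply (t : ℝ) (x : CrossedProduct γ) : dualAut γ t x = dualL γ t x := rfl

lemma dualAut_of_single (t : ℝ) (n : ℤ) (b : B) :
    dualAut γ t (of (TwistedCc.single n b)) =
      Complex.exp (Complex.I * n * t) • of (TwistedCc.single n b) := by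
  rw [dualAut_apply, dualL_of, TwistedCc.dual_single, ← TwistedCc.smul_single, of_smul]

lemma continuous_dualAut (x : CrossedProduct γ) : Continuous fun t : ℝ => dualAut γ t x := by
  have hf : ∀ f : TwistedCc γ, Continuous fun t : ℝ => dualAut γ t (of f) := by
    intro f
    induction f using TwistedCc.induction_single with
    | zero => simp only [map_zero]; exact continuous_const
    | add f g hf hg => simp only [map_add]; exact hf.add hg
    | single n b =>
      simp only [dualAut_of_single]
      have h : Continuous fun t : ℝ => Complex.exp (Complex.I * n * t) := by fun_prop
      exact h.smul continuous_const
  refine continuous_of_uniform_approx_of_continuous fun u hu => ?_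
  obtain ⟨ε, hε, hu⟩ := Metric.mem_uniformity_dist.1 hu
  obtain ⟨f, hfx⟩ := denseRange_of.exists_dist_lt x hε
  refine ⟨fun t => dualAut γ t (of f), hf f, fun t => hu ?_⟩
  rw [dist_eq_norm, ← map_sub, dualAut_apply, norm_dualL, ← dist_eq_norm]
  exact hfx

/-- The dual action on `B ⋊_γ ℤ`, considered as a (`2π`-periodic) flow. -/
noncomputable def dualFlow (γ : B ≃⋆ₐ[ℂ] B) : CStarFlow (CrossedProduct γ) where
  aut := dualAut γ
  aut_zero := by ext x; exact dualL_zero x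
  aut_add s t := by ext x; exact dualL_add s t x
  continuous_aut := continuous_dualAut

lemma dualFlow_periodic (γ : B ≃⋆ₐ[ℂ] B) (t : ℝ) :
    (dualFlow γ).aut (t + 2 * Real.pi) = (dualFlow γ).aut t := by
  ext x
  change dualL γ (t + 2 * Real.pi) x = dualL γ t x
  induction x using induction_of with
  | hp => exact isClosed_eq (dualL γ _).continuous (dualL γ t).continuous
  | ih f =>
    rw [dualL_of, dualL_of]
    congr 1
    induction f using TwistedCc.induction_single with
    | zero => simp
    | add f g hf hg => simp only [map_add, hf, hg]
    | single n b =>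
      rw [TwistedCc.dual_single, TwistedCc.dual_single]
      congr 2
      rw [Complex.exp_eq_exp_iff_exists_int]
      exact ⟨n, by push_cast; ring⟩

end CrossedProduct

section Weights

open scoped ENNReal NNReal

/-- The positive cone `A₊` of a C⋆-algebra. -/
abbrev PosCone (A : Type*) [NonUnitalCStarAlgebra A] [PartialOrder A] : Type _ := {a : A // 0 ≤ a}

variable {A : Type*} [NonUnitalCStarAlgebra A] [PartialOrder A] [StarOrderedRing A]

/-- A weight `A₊ → [0, ∞]`: additive, positively homogeneous (`0 · ∞ = 0`), non-zero, densely
defined and lower semi-continuous. -/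
structure IsWeight (ω : PosCone A → ℝ≥0∞) : Prop where
  map_add : ∀ a b : PosCone A, ω ⟨a + b, add_nonneg a.2 b.2⟩ = ω a + ω b
  map_smul : ∀ (r : ℝ≥0) (a : PosCone A), ω ⟨(r : ℝ) • (a : A), smul_nonneg r.2 a.2⟩ = r * ω a
  ne_zero : ∃ a, ω a ≠ 0
  denselyDefined : Dense {a : PosCone A | ω a < ∞}
  lowerSemicontinuous : LowerSemicontinuous ω

/-- A trace is a weight with `τ(a*a) = τ(aa*)`. -/
structure IsTrace (τ : PosCone A → ℝ≥0∞) : Prop extends IsWeight τ where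
  tracial : ∀ a : A, τ ⟨star a * a, star_mul_self_nonneg a⟩ = τ ⟨a * star a, mul_star_self_nonneg a⟩

/-- `θ.HasExtension z a b` says that `a ∈ D(θ_z)` and `θ_z(a) = b`: there is a function that is
continuous on the closed horizontal strip between `ℝ` and `ℝ + z`, holomorphic in its interior,
equal to `t ↦ θ_t(a)` on `ℝ`, and equal to `b` at `z`. -/
def CStarFlow.HasExtension {A : Type*} [NonUnitalCStarAlgebra A] (θ : CStarFlow A) (z : ℂ)
    (a b : A) : Prop :=
  ∃ f : ℂ → A, ContinuousOn f {w | w.im ∈ Set.uIcc 0 z.im} ∧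
    DifferentiableOn ℂ f (interior {w | w.im ∈ Set.uIcc 0 z.im}) ∧
    (∀ t : ℝ, f t = θ.aut t a) ∧ f z = b

/-- A `β`-KMS weight for the flow `θ`: a `θ`-invariant weight with
`ω(a*a) = ω(θ_{-iβ/2}(a) θ_{-iβ/2}(a)*)` for all `a ∈ D(θ_{-iβ/2})`. -/
structure IsKMSWeight (θ : CStarFlow A) (β : ℝ) (ω : PosCone A → ℝ≥0∞) : Prop extends
    IsWeight ω where
  invariant : ∀ (t : ℝ) (a : PosCone A), ω ⟨θ.aut t a, map_nonneg (θ.aut t) a.2⟩ = ω a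
  kms : ∀ a b : A, θ.HasExtension (-(Complex.I * β / 2)) a b →
    ω ⟨star a * a, star_mul_self_nonneg a⟩ = ω ⟨b * star b, mul_star_self_nonneg b⟩

variable {B : Type*} [NonUnitalCStarAlgebra B] [PartialOrder B] [StarOrderedRing B]

/-- The restriction `ω|_B` of a weight on `B ⋊_γ ℤ` to `B`. -/
noncomputable def restrictWeight (γ : B ≃⋆ₐ[ℂ] B) (ω : PosCone (CrossedProduct γ) → ℝ≥0∞) :
    PosCone B → ℝ≥0∞ :=
  fun b => ω ⟨CrossedProduct.embed γ b, map_nonneg (CrossedProduct.embed γ) b.2⟩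

/-- The composition `τ ∘ P` with the canonical conditional expectation. -/
noncomputable def compExpectation (γ : B ≃⋆ₐ[ℂ] B) (τ : PosCone B → ℝ≥0∞) :
    PosCone (CrossedProduct γ) → ℝ≥0∞ :=
  fun x => τ ⟨CrossedProduct.expectation γ x, CrossedProduct.expectation_nonneg x.2⟩

end Weights

/-! A trace with the scaling property extends by `τ ∘ P`, and the content of the theorem is that
this gives a KMS weight and that every KMS weight `ω` arises this way.

From traces to weights, the tool is Parseval's identity `hasSum_fourier`: `P(x x*) = ∑ xₙ xₙ*` in
norm, where `xₙ` is the `n`-th Fourier coefficient. Weights are countably additive for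
norm-convergent sums (`map_hasSum`), so `τ(P(x x*)) = ∑ τ(xₙ xₙ*)`. If `b = θ_{-iβ/2}(a)`,
uniqueness of analytic continuation gives `bₙ = e^{nβ/2} aₙ` (`fourier_hasExtension`). Since `(a*)₋ₙ
= γ⁻ⁿ(aₙ*)`, the scaling and the trace property show that the `-n` term for `a*` and the `n` term
for `b` are both `e^{nβ} τ(aₙ aₙ*)`. The KMS identity therefore holds term by term.

From weights to traces, the KMS condition on elements of `B` gives the trace property, and on
elements `b u` it gives the scaling. What remains is `ω = (ω|_B) ∘ P`. Averages of `x` over roots of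
unity under the dual action have the same weight as `x` and converge in norm to `P(x)`, so lower
semicontinuity gives `ω(P x) ≤ ω(x)`.

For the reverse inequality, `x` is compressed to `e x e` with `e ∈ B₊` of finite weight. The
averaging error is then at most a small multiple of `ω(e²) < ∞`, so `ω(e x e) ≤ ω(e P(x) e)`
(`weight_conj_le`). The trace property bounds the right side by `‖e‖² ω(P x)`. Letting `e`
approximate a unit, lower semicontinuity finishes the argument. -/

/-! ### Uniqueness of holomorphic continuation from the edge of a strip. -/

open Filter Topology in
/-- A function that is continuous on a closed horizontal strip, holomorphic in its interior and zero
on the real line, which bounds the strip, vanishes on the whole strip. -/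
theorem eq_zero_of_strip {c : ℝ} {h : ℂ → ℂ}
    (hc : ContinuousOn h {w | w.im ∈ Set.uIcc 0 c})
    (hd : DifferentiableOn ℂ h (interior {w | w.im ∈ Set.uIcc 0 c}))
    (h0 : ∀ t : ℝ, h t = 0) {w : ℂ} (hw : w.im ∈ Set.uIcc 0 c) : h w = 0 := by
  rcases eq_or_ne c 0 with rfl | hc0
  · have hw0 : w.im = 0 := by simpa using hw
    rw [show w = (w.re : ℂ) from Complex.ext rfl (by simpa using hw0)]
    exact h0 _
  set V : Set ℂ := Complex.im ⁻¹' Set.Ioo (min 0 c) (max 0 c) with hV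
  have hlt : min 0 c < max 0 c := min_lt_max.2 hc0.symm
  have hint : interior {w : ℂ | w.im ∈ Set.uIcc 0 c} = V := by
    change interior (Complex.im ⁻¹' Set.Icc _ _) = _
    rw [Complex.interior_preimage_im, interior_Icc]
  have hcl : closure V = {w : ℂ | w.im ∈ Set.uIcc 0 c} := by
    rw [hV, Complex.closure_preimage_im, closure_Ioo hlt.ne]; rfl
  rw [hint] at hd
  have hdc : DiffContOnCl ℂ h V := ⟨hd, by rwa [hcl]⟩
  have hVo : IsOpen V := isOpen_Ioo.preimage Complex.continuous_im
  -- Take the square centred at `p` whose half-side is the distance from `p` to the real line; in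
  -- the half of the strip next to the real line it stays inside the closed strip. In the product
  -- `h(p + w) h(p - w) h(p + iw) h(p - iw)`, each side of the square puts one factor on the real
  -- line. The product vanishes on the frontier, hence at the centre, where it equals `h(p)⁴`.
  have near : ∀ p : ℂ, p.im ∈ Set.Ioo (min 0 (c / 2)) (max 0 (c / 2)) → h p = 0 := by
    intro p hp
    set r : ℝ := |p.im| with hr
    have hp0 : p.im ≠ 0 := by
      intro h; rw [h] at hp
      rcases le_total 0 (c / 2) with h' | h' <;> simp_all
    have hr0 : 0 < r := abs_pos.2 hp0
    have hmem : ∀ y : ℝ, |y| < r → p.im + y ∈ Set.Ioo (min 0 c) (max 0 c) := by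
      intro y hy
      rcases le_total 0 c with h' | h'
      · have h2 : 0 ≤ c / 2 := by linarith
        rw [min_eq_left h2, max_eq_right h2] at hp
        rw [min_eq_left h', max_eq_right h']
        rw [hr, abs_of_pos hp.1, abs_lt] at hy
        exact ⟨by linarith, by linarith [hp.2]⟩
      · have h2 : c / 2 ≤ 0 := by linarith
        rw [min_eq_right h2, max_eq_left h2] at hp
        rw [min_eq_right h', max_eq_left h']
        rw [hr, abs_of_neg hp.2, abs_lt] at hy
        exact ⟨by linarith [hp.1], by linarith⟩
    set U : Set ℂ := Set.Ioo (-r) r ×ℂ Set.Ioo (-r) r with hU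
    have fac : ∀ ζ : ℂ, (∀ w ∈ U, |(ζ * w).im| < r) →
        DiffContOnCl ℂ (fun w => h (p + ζ * w)) U := fun ζ hζ =>
      hdc.comp (Differentiable.diffContOnCl (by fun_prop)) fun w hw => by
        change (p + ζ * w).im ∈ Set.Ioo (min 0 c) (max 0 c)
        rw [Complex.add_im]; exact hmem _ (hζ w hw)
    have hUm : ∀ w ∈ U, |w.re| < r ∧ |w.im| < r := fun w hw =>
      ⟨abs_lt.2 (Complex.mem_reProdIm.1 hw).1, abs_lt.2 (Complex.mem_reProdIm.1 hw).2⟩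
    have d1 := fac 1 fun w hw => by simpa using (hUm w hw).2
    have d2 := fac (-1) fun w hw => by simpa using (hUm w hw).2
    have d3 := fac Complex.I fun w hw => by simpa using (hUm w hw).1
    have d4 := fac (-Complex.I) fun w hw => by simpa using (hUm w hw).1
    have d := ((d1.smul d2).smul d3).smul d4
    have hz : ∀ z : ℂ, z.im = 0 → h z = 0 := fun z hz => by
      rw [show z = (z.re : ℂ) from Complex.ext rfl (by simpa using hz)]; exact h0 _
    have hUb : Bornology.IsBounded U :=
      (Metric.isBounded_Ioo _ _).reProdIm (Metric.isBounded_Ioo _ _)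
    have key := Complex.eqOn_of_eqOn_frontier hUb d (g := fun _ => 0)
      (diffContOnCl_const) (fun z hz' => by
        have hrr : -r < r := by linarith
        have h4 : z.im = -p.im ∨ z.im = p.im ∨ z.re = -p.im ∨ z.re = p.im := by
          rw [hU, Complex.frontier_reProdIm, frontier_Ioo hrr] at hz'
          have habs : r = p.im ∨ r = -p.im := abs_choice p.im
          rcases hz' with hz' | hz'
          · rcases (Complex.mem_reProdIm.1 hz').2 with h | h <;> rcases habs with h' | h' <;>
              rw [h'] at h <;> grind
          · rcases (Complex.mem_reProdIm.1 hz').1 with h | h <;> rcases habs with h' | h' <;>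
              rw [h'] at h <;> grind
        simp only [smul_eq_mul, mul_eq_zero]
        rcases h4 with h | h | h | h
        · exact .inl (.inl (.inl (hz _ (by simp [h]))))
        · exact .inl (.inl (.inr (hz _ (by simp [h]))))
        · exact .inl (.inr (hz _ (by simp [h])))
        · exact .inr (hz _ (by simp [h])))
    have := key (Complex.mem_reProdIm.2 (by simp [hr0]) : (0 : ℂ) ∈ U)
    simpa using this
  -- The height `c / 4` provides an interior point of the half strip, from which the identity
  -- theorem spreads the zeros over the open strip and continuity over its closure.
  have hmid : c / 4 ∈ Set.Ioo (min 0 (c / 2)) (max 0 (c / 2)) := by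
    rcases lt_or_gt_of_ne hc0 with h' | h'
    · rw [min_eq_right (by linarith), max_eq_left (by linarith)]
      constructor <;> linarith
    · rw [min_eq_left (by linarith), max_eq_right (by linarith)]
      constructor <;> linarith
  have hmid' : c / 4 ∈ Set.Ioo (min 0 c) (max 0 c) := by
    rcases lt_or_gt_of_ne hc0 with h' | h'
    · rw [min_eq_right (by linarith), max_eq_left (by linarith)]
      constructor <;> linarith
    · rw [min_eq_left (by linarith), max_eq_right (by linarith)]
      constructor <;> linarith
  set p₀ : ℂ := ⟨0, c / 4⟩
  have hev : h =ᶠ[𝓝 p₀] 0 := by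
    filter_upwards [(isOpen_Ioo.preimage Complex.continuous_im).mem_nhds
      (show p₀ ∈ Complex.im ⁻¹' Set.Ioo (min 0 (c / 2)) (max 0 (c / 2)) from hmid)] with p hp
    exact near p hp
  have hpre : IsPreconnected V := by
    refine Convex.isPreconnected ?_
    exact (convex_Ioo _ _).linear_preimage Complex.imLm
  have hzero : Set.EqOn h 0 V :=
    (hd.analyticOnNhd hVo).eqOn_zero_of_preconnected_of_eventuallyEq_zero hpre
      (show p₀ ∈ V from hmid') hev
  have hcl' : Set.EqOn h 0 (closure V) :=
    hzero.of_subset_closure (by rwa [hcl]) continuousOn_const subset_closure le_rfl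
  exact hcl' (by rw [hcl]; exact hw)

/-! ### Coefficients of finitely supported elements. -/

namespace TwistedCc

variable {B : Type*} [NonUnitalCStarAlgebra B] {γ : B ≃⋆ₐ[ℂ] B}

lemma coeff_mul_star_single (f : TwistedCc γ) (n : ℤ) (b : B) :
    (f * star (single n b)).coeff 0 = f.coeff n * star b := by
  induction f using induction_single with
  | zero => simp
  | add f f' hf hf' => simp only [add_mul, coeff_add, hf, hf']
  | single m a =>
    by_cases h : m = n
    · subst h
      simp only [star_single, single_mul_single, zpow_apply_zpow]
      simp [coeff_single]
    · have : m + -n ≠ 0 := by omega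
      simp [coeff_single, h, this]

/-- With `c = f(n)`, the element `c c*` is the zeroth coefficient of `f (c uⁿ)*`. The bound for the
zeroth coefficient gives `‖c‖² ≤ ‖f‖ ‖c‖`. -/
lemma norm_coeff_le (f : TwistedCc γ) (n : ℤ) : ‖f.coeff n‖ ≤ ‖f‖ := by
  rcases eq_or_lt_of_le (norm_nonneg (f.coeff n)) with h | h
  · rw [← h]; exact norm_nonneg f
  refine le_of_mul_le_mul_right ?_ h
  rw [← CStarRing.norm_self_mul_star, ← coeff_mul_star_single]
  calc _ ≤ ‖f * star (single n (f.coeff n) : TwistedCc γ)‖ := norm_coeff_zero_le _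
    _ ≤ ‖f‖ * ‖star (single n (f.coeff n) : TwistedCc γ)‖ := norm_mul_le _ _
    _ ≤ _ := by
      rw [norm_star]
      exact mul_le_mul_of_nonneg_left (norm_single_le _ _) (norm_nonneg _)

lemma coeff_star (f : TwistedCc γ) (n : ℤ) :
    (star f).coeff n = (γ ^ n) (star (f.coeff (-n))) := by
  induction f using induction_single with
  | zero => simp
  | add f f' hf hf' => simp only [star_add, coeff_add, hf, hf', map_add]
  | single m a =>
    by_cases h : m = -n
    · subst h; simp [coeff_single]
    · have : -m ≠ n := by omega
      simp [coeff_single, h, this]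

lemma coeff_dual (t : ℝ) (f : TwistedCc γ) (n : ℤ) :
    (dual t f).coeff n = Complex.exp (Complex.I * n * t) • f.coeff n := by
  induction f using induction_single with
  | zero => simp
  | add f f' hf hf' => simp only [map_add, coeff_add, hf, hf', smul_add]
  | single m a =>
    by_cases h : m = n
    · subst h; simp [coeff_single]
    · simp [coeff_single, h]

lemma coeff_single_mul_mul_single (f : TwistedCc γ) (a b : B) :
    (single 0 a * f * single 0 b).coeff 0 = a * f.coeff 0 * b := by
  induction f using induction_single with
  | zero => simp
  | add f f' hf hf' => simp only [mul_add, add_mul, coeff_add, hf, hf']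
  | single m c =>
    by_cases h : m = 0
    · subst h; simp [coeff_single]
    · simp [coeff_single, h]

lemma sum_single_coeff {f : TwistedCc γ} {F : Finset ℤ} (h : Finsupp.support f ⊆ F) :
    ∑ n ∈ F, (single n (f.coeff n) : TwistedCc γ) = f :=
  (Finsupp.sum_of_support_subset (f : ℤ →₀ B) h (fun n b => Finsupp.single n b)
    fun n _ => Finsupp.single_zero n).symm.trans (Finsupp.sum_single _)

end TwistedCc

/-! ### Fourier coefficients and Parseval's identity in the crossed product. -/

namespace CrossedProduct

open Filter Topology

variable {B : Type*} [NonUnitalCStarAlgebra B] {γ : B ≃⋆ₐ[ℂ] B}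

/-- The `n`-th coefficient `f ↦ f(n)` on `C_c(ℤ, B)`, as a contraction. -/
noncomputable def coeffL (γ : B ≃⋆ₐ[ℂ] B) (n : ℤ) : TwistedCc γ →L[ℂ] B :=
  LinearMap.mkContinuous
    { toFun := fun f => f.coeff n
      map_add' := fun f g => TwistedCc.coeff_add f g n
      map_smul' := fun c f => TwistedCc.coeff_smul c f n }
    1 fun f => by
      rw [one_mul]
      exact TwistedCc.norm_coeff_le f n

/-- The `n`-th Fourier coefficient on the crossed product. -/
noncomputable def fourier (γ : B ≃⋆ₐ[ℂ] B) (n : ℤ) : CrossedProduct γ →L[ℂ] B :=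
  (coeffL γ n).extend (of (γ := γ)).toContinuousLinearMap

lemma fourier_of (n : ℤ) (f : TwistedCc γ) : fourier γ n (of f) = f.coeff n :=
  (coeffL γ n).extend_eq (e := (of (γ := γ)).toContinuousLinearMap)
    denseRange_of isUniformInducing_of f

lemma fourier_zero (x : CrossedProduct γ) : fourier γ 0 x = expectation γ x := by
  induction x using induction_of with
  | hp => exact isClosed_eq (fourier γ 0).continuous (expectation γ).continuous
  | ih f => rw [fourier_of, expectation_of]

/-- For the `B`-valued inner product `P(x y*)`, Fourier coefficients are obtained by pairing with
the elements `b uⁿ`. -/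
lemma expectation_mul_star_single (x : CrossedProduct γ) (n : ℤ) (b : B) :
    expectation γ (x * star (of (TwistedCc.single n b))) = fourier γ n x * star b := by
  induction x using induction_of with
  | hp =>
    refine isClosed_eq ((expectation γ).continuous.comp (continuous_id.mul continuous_const))
      ((fourier γ n).continuous.mul continuous_const)
  | ih f =>
    rw [← of_star, ← of_mul, expectation_of, fourier_of, TwistedCc.coeff_mul_star_single]

lemma continuous_zpow (n : ℤ) : Continuous (γ ^ n : B ≃⋆ₐ[ℂ] B) :=
  (NonUnitalStarAlgHom.isometry (γ ^ n) (EquivLike.injective (γ ^ n))).continuous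

/-- The twist by `γⁿ` is what later converts the scaling of a trace into the factors `e^{nβ}` of the
KMS condition. -/
lemma fourier_star (x : CrossedProduct γ) (n : ℤ) :
    fourier γ n (star x) = (γ ^ n) (star (fourier γ (-n) x)) := by
  induction x using induction_of with
  | hp =>
    exact isClosed_eq ((fourier γ n).continuous.comp continuous_star)
      ((continuous_zpow n).comp (continuous_star.comp (fourier γ (-n)).continuous))
  | ih f => rw [← of_star, fourier_of, fourier_of, TwistedCc.coeff_star]

lemma expectation_star (x : CrossedProduct γ) :
    expectation γ (star x) = star (expectation γ x) := by
  rw [← fourier_zero, fourier_star, neg_zero, zpow_zero, fourier_zero]; rfl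

lemma fourier_dualL (t : ℝ) (x : CrossedProduct γ) (n : ℤ) :
    fourier γ n (dualL γ t x) = Complex.exp (Complex.I * n * t) • fourier γ n x := by
  induction x using induction_of with
  | hp =>
    exact isClosed_eq ((fourier γ n).continuous.comp (dualL γ t).continuous)
      ((fourier γ n).continuous.const_smul _)
  | ih f => rw [dualL_of, fourier_of, fourier_of, TwistedCc.coeff_dual]

lemma expectation_dualL (t : ℝ) (x : CrossedProduct γ) :
    expectation γ (dualL γ t x) = expectation γ x := by
  rw [← fourier_zero, fourier_dualL, fourier_zero]; simp

lemma norm_embed_le (b : B) : ‖embed γ b‖ ≤ ‖b‖ := NonUnitalStarAlgHom.norm_apply_le (embed γ) b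

lemma continuous_embed : Continuous (embed γ) :=
  AddMonoidHomClass.continuous_of_bound (embed γ) 1 fun b => by
    rw [one_mul]; exact norm_embed_le b

lemma dualL_embed (t : ℝ) (b : B) : dualL γ t (embed γ b) = embed γ b := by
  rw [embed_apply, dualL_of, TwistedCc.dual_single]; simp

lemma expectation_embed_mul_mul_embed (x : CrossedProduct γ) (a b : B) :
    expectation γ (embed γ a * x * embed γ b) = a * expectation γ x * b := by
  induction x using induction_of with
  | hp =>
    exact isClosed_eq
      ((expectation γ).continuous.comp ((continuous_const.mul continuous_id).mul continuous_const))
      ((continuous_const.mul (expectation γ).continuous).mul continuous_const)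
  | ih f =>
    rw [embed_apply, embed_apply, ← of_mul, ← of_mul, expectation_of, expectation_of,
      TwistedCc.coeff_single_mul_mul_single]

/-- The remainder of `x` after removing the terms `bₙ uⁿ` with `n ∈ F`. -/
noncomputable def remainder (γ : B ≃⋆ₐ[ℂ] B) (F : Finset ℤ) (x : CrossedProduct γ) :
    CrossedProduct γ := x - ∑ n ∈ F, of (TwistedCc.single n (fourier γ n x))

lemma remainder_of {F : Finset ℤ} {f : TwistedCc γ} (h : Finsupp.support f ⊆ F) :
    remainder γ F (of f) = 0 := by
  simp only [remainder, fourier_of]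
  rw [← map_sum, TwistedCc.sum_single_coeff h, sub_self]

lemma remainder_sub (F : Finset ℤ) (x y : CrossedProduct γ) :
    remainder γ F (x - y) = remainder γ F x - remainder γ F y := by
  have h : ∀ n, of (TwistedCc.single n (fourier γ n (x - y)) : TwistedCc γ) =
      of (TwistedCc.single n (fourier γ n x)) - of (TwistedCc.single n (fourier γ n y)) := by
    intro n
    rw [map_sub, ← TwistedCc.singleHom_apply, map_sub, map_sub]; rfl
  simp only [remainder, h, Finset.sum_sub_distrib]
  abel

/-- This is Pythagoras for the inner product `P(x y*)`: with `s` the partial sum over `F`, the terms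
`P(x s*)`, `P(s x*)` and `P(s s*)` all equal `S`. -/
lemma expectation_remainder (F : Finset ℤ) (x : CrossedProduct γ) :
    expectation γ (remainder γ F x * star (remainder γ F x)) =
      expectation γ (x * star x) - ∑ n ∈ F, fourier γ n x * star (fourier γ n x) := by
  set S := ∑ n ∈ F, fourier γ n x * star (fourier γ n x) with hS
  set s : CrossedProduct γ := ∑ n ∈ F, of (TwistedCc.single n (fourier γ n x)) with hs
  have hSs : star S = S := by simp [hS, star_sum]
  have h1 : ∀ y : CrossedProduct γ, expectation γ (y * star s) =
      ∑ n ∈ F, fourier γ n y * star (fourier γ n x) := by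
    intro y
    rw [hs, star_sum, Finset.mul_sum, map_sum]
    exact Finset.sum_congr rfl fun n _ => expectation_mul_star_single y n _
  have h2 : expectation γ (x * star s) = S := h1 x
  have h3 : expectation γ (s * star x) = S := by
    rw [← hSs, ← h2, ← expectation_star, star_mul, star_star]
  have h4 : expectation γ (s * star s) = S := by
    rw [h1]
    refine Finset.sum_congr rfl fun m hm => ?_
    congr 1
    rw [hs, map_sum]
    simp only [fourier_of, TwistedCc.coeff_single]
    rw [Finset.sum_ite_eq' F m, if_pos hm]
  rw [remainder, star_sub, sub_mul, mul_sub, mul_sub, map_sub, map_sub, map_sub, h2, h3, h4]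
  abel

section

variable [PartialOrder B] [StarOrderedRing B]

/-- Parseval's identity. -/
lemma hasSum_fourier (x : CrossedProduct γ) :
    HasSum (fun n => fourier γ n x * star (fourier γ n x)) (expectation γ (x * star x)) := by
  -- The difference is positive and dominated by `P(y y*)`, so the bound does not depend on `F`;
  -- this allows the density argument below.
  have bd : ∀ (F : Finset ℤ) (y : CrossedProduct γ),
      ‖expectation γ (y * star y) - ∑ n ∈ F, fourier γ n y * star (fourier γ n y)‖ ≤
        ‖expectation γ‖ * ‖y‖ ^ 2 := by
    intro F y
    refine (CStarAlgebra.norm_le_norm_of_nonneg_of_le ?_ ?_).trans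
      (b := ‖expectation γ (y * star y)‖) ?_
    · rw [← expectation_remainder]; exact expectation_nonneg (mul_star_self_nonneg _)
    · exact sub_le_self _ (Finset.sum_nonneg fun _ _ => mul_star_self_nonneg _)
    · refine ((expectation γ).le_opNorm _).trans ?_
      rw [CStarRing.norm_self_mul_star, sq]
  refine Metric.tendsto_atTop.2 fun ε hε => ?_
  obtain ⟨δ, hδ, hδε⟩ : ∃ δ : ℝ, 0 < δ ∧ ‖expectation γ‖ * δ ^ 2 < ε := by
    have ht : Tendsto (fun δ : ℝ => ‖expectation γ‖ * δ ^ 2) (𝓝[>] 0) (𝓝 0) := by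
      have : Continuous fun δ : ℝ => ‖expectation γ‖ * δ ^ 2 := by fun_prop
      simpa using (this.tendsto 0).mono_left nhdsWithin_le_nhds
    obtain ⟨δ, h1, h2⟩ := ((ht.eventually (gt_mem_nhds hε)).and self_mem_nhdsWithin).exists
    exact ⟨δ, h2, h1⟩
  obtain ⟨f, hf⟩ := denseRange_of.exists_dist_lt x hδ
  rw [dist_eq_norm] at hf
  refine ⟨Finsupp.support f, fun F hF => ?_⟩
  rw [dist_comm, dist_eq_norm]
  refine lt_of_le_of_lt ?_ hδε
  rw [← expectation_remainder]
  -- Once `F` contains the support of `f`, subtracting `f` leaves the remainder unchanged, and `x -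
  -- f` is small.
  have : remainder γ F x = remainder γ F (x - of f) := by
    rw [remainder_sub, remainder_of hF, sub_zero]
  rw [this, expectation_remainder]
  refine (bd F _).trans ?_
  gcongr

end

/-! ### The expectation as a limit of finite averages over the dual action. -/

/-- The average of `x` over the `(N+1)`-st roots of unity. -/
noncomputable def average (γ : B ≃⋆ₐ[ℂ] B) (N : ℕ) : CrossedProduct γ →L[ℂ] CrossedProduct γ :=
  ((N + 1 : ℝ)⁻¹ : ℂ) • ∑ k ∈ Finset.range (N + 1), dualL γ (2 * Real.pi * k / (N + 1))

lemma average_apply (N : ℕ) (x : CrossedProduct γ) : average γ N x =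
    ((N + 1 : ℝ)⁻¹ : ℝ) • ∑ k ∈ Finset.range (N + 1), dualL γ (2 * Real.pi * k / (N + 1)) x := by
  simp only [average, FunLike.coe_smul, Pi.smul_apply, sum_apply]
  rw [← Complex.coe_smul]
  push_cast
  rfl

lemma norm_average_le (N : ℕ) (x : CrossedProduct γ) : ‖average γ N x‖ ≤ ‖x‖ := by
  have hN : (0 : ℝ) < N + 1 := by positivity
  rw [average_apply, norm_smul, norm_inv, Real.norm_of_nonneg hN.le, inv_mul_le_iff₀ hN]
  refine (norm_sum_le _ _).trans ?_
  simp [norm_dualL]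

lemma average_nonneg (N : ℕ) {x : CrossedProduct γ} (hx : 0 ≤ x) : 0 ≤ average γ N x := by
  rw [average_apply]
  refine smul_nonneg (by positivity) (Finset.sum_nonneg fun k _ => ?_)
  exact map_nonneg (dualAut γ _) hx

/-- Averaging multiplies `b uⁿ` by the mean of the powers of an `(N+1)`-st root of unity `ζ`. Since
`0 < |n| ≤ N`, `N + 1` does not divide `n`, so `ζ ≠ 1` and the geometric sum vanishes. -/
lemma average_single {n : ℤ} (hn : n ≠ 0) (b : B) {N : ℕ} (hN : n.natAbs ≤ N) :
    average γ N (of (TwistedCc.single n b)) = 0 := by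
  have hN0 : (N + 1 : ℂ) ≠ 0 := by exact_mod_cast N.succ_ne_zero
  set ζ : ℂ := Complex.exp (Complex.I * n * (2 * Real.pi) / (N + 1)) with hζ
  have hk : ∀ k : ℕ, dualL γ (2 * Real.pi * k / (N + 1)) (of (TwistedCc.single n b)) =
      ζ ^ k • of (TwistedCc.single n b) := by
    intro k
    rw [← dualAut_apply, dualAut_of_single, hζ, ← Complex.exp_nat_mul]
    congr 2
    push_cast
    ring
  have h1 : ζ ^ (N + 1) = 1 := by
    rw [hζ, ← Complex.exp_nat_mul, Complex.exp_eq_one_iff]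
    refine ⟨n, ?_⟩
    push_cast
    field_simp
  have h2 : ζ ≠ 1 := by
    rw [hζ, Ne, Complex.exp_eq_one_iff]
    rintro ⟨m, hm⟩
    have hpi : (2 * Real.pi * Complex.I : ℂ) ≠ 0 := Complex.two_pi_I_ne_zero
    have hm' : (n : ℂ) = m * (N + 1) := by
      refine mul_right_cancel₀ hpi ?_
      field_simp at hm
      linear_combination (2 * Real.pi * Complex.I : ℂ) * hm
    have hm'' : n = m * (N + 1) := by exact_mod_cast hm'
    rcases eq_or_ne m 0 with rfl | h0
    · simp at hm''; exact hn hm''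
    have : N + 1 ≤ n.natAbs := by
      rw [hm'', Int.natAbs_mul]
      have h3 : 1 ≤ m.natAbs := Int.natAbs_pos.2 h0
      have h4 : ((N : ℤ) + 1).natAbs = N + 1 := by omega
      rw [h4]
      exact Nat.le_mul_of_pos_left _ h3
    omega
  rw [average_apply]
  simp only [hk]
  rw [← Finset.sum_smul, geom_sum_eq h2, h1]
  simp

lemma average_embed (b : B) (N : ℕ) : average γ N (embed γ b) = embed γ b := by
  rw [average_apply]
  simp only [dualL_embed, Finset.sum_const, Finset.card_range]
  have hN : (N + 1 : ℝ) ≠ 0 := by positivity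
  rw [← Nat.cast_smul_eq_nsmul ℝ, smul_smul]
  push_cast
  rw [inv_mul_cancel₀ hN, one_smul]

/-- On finite sums the averages are eventually equal to the expectation, and contractivity of both
sides extends the convergence. Finite averages replace the integral over the circle, so that
additivity of a weight suffices to evaluate them. -/
lemma tendsto_average (x : CrossedProduct γ) :
    Tendsto (fun N => average γ N x) atTop (𝓝 (embed γ (expectation γ x))) := by
  have hf : ∀ f : TwistedCc γ,
      Tendsto (fun N => average γ N (of f)) atTop (𝓝 (embed γ (expectation γ (of f)))) := by
    intro f
    induction f using TwistedCc.induction_single with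
    | zero => simp only [map_zero]; exact tendsto_const_nhds
    | add f g hf hg => simp only [map_add]; exact hf.add hg
    | single n b =>
      by_cases hn : n = 0
      · subst hn
        rw [← embed_apply, expectation_embed]
        simp only [average_embed]
        exact tendsto_const_nhds
      · rw [expectation_of, TwistedCc.coeff_single, if_neg hn, map_zero]
        refine tendsto_const_nhds.congr' ?_
        filter_upwards [eventually_ge_atTop n.natAbs] with N hN
        rw [average_single hn b hN]
  have hE : ∀ y : CrossedProduct γ, ‖embed γ (expectation γ y)‖ ≤ ‖y‖ := by
    intro y
    refine (norm_embed_le _).trans ?_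
    induction y using induction_of with
    | hp => exact isClosed_le (expectation γ).continuous.norm continuous_norm
    | ih f => rw [expectation_of, norm_of]; exact TwistedCc.norm_coeff_zero_le f
  refine Metric.tendsto_atTop.2 fun ε hε => ?_
  obtain ⟨f, hfx⟩ := denseRange_of.exists_dist_lt x (show 0 < ε / 3 by positivity)
  obtain ⟨N₀, hN₀⟩ := Metric.tendsto_atTop.1 (hf f) (ε / 3) (by positivity)
  refine ⟨N₀, fun N hN => ?_⟩
  have h1 := norm_average_le N (x - of f)
  have h2 := hE (x - of f)
  have h3 := hN₀ N hN
  rw [dist_eq_norm] at hfx h3 ⊢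
  have h4 : average γ N x - embed γ (expectation γ x) = average γ N (x - of f) +
      (average γ N (of f) - embed γ (expectation γ (of f))) -
      embed γ (expectation γ (x - of f)) := by
    simp only [map_sub]; abel
  rw [h4]
  have h5 := norm_sub_le (average γ N (x - of f) +
      (average γ N (of f) - embed γ (expectation γ (of f)))) (embed γ (expectation γ (x - of f)))
  have h6 := norm_add_le (average γ N (x - of f))
      (average γ N (of f) - embed γ (expectation γ (of f)))
  linarith

/-! ### Analytic continuation of the dual action. -/

/-- The orbit of `b uⁿ` is entire, so the KMS condition can be tested on it; the cases `n = 0` and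
`n = 1` yield the trace property and the scaling. -/
lemma hasExtension_single (n : ℤ) (b : B) (z : ℂ) :
    (dualFlow γ).HasExtension z (of (TwistedCc.single n b))
      (Complex.exp (Complex.I * n * z) • of (TwistedCc.single n b)) := by
  have h : Differentiable ℂ fun w : ℂ => Complex.exp (Complex.I * n * w) •
      (of (TwistedCc.single n b) : CrossedProduct γ) :=
    Differentiable.smul_const (by fun_prop) _
  exact ⟨_, h.continuous.continuousOn, h.differentiableOn,
    fun t => (dualAut_of_single t n b).symm, rfl⟩

lemma fourier_hasExtension {z : ℂ} {a b : CrossedProduct γ}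
    (h : (dualFlow γ).HasExtension z a b) (n : ℤ) :
    fourier γ n b = Complex.exp (Complex.I * n * z) • fourier γ n a := by
  obtain ⟨f, hc, hd, h0, rfl⟩ := h
  -- Continuous functionals reduce the claim to scalar functions. The `n`-th coefficient of the
  -- orbit and the exponential agree on the real line, hence on the whole strip.
  refine (SeparatingDual.eq_iff_forall_dual_eq (R := ℂ)).2 fun φ => ?_
  have key := eq_zero_of_strip (c := z.im) (w := z)
    (h := fun w => (φ.comp (fourier γ n)) (f w) -
      Complex.exp (Complex.I * n * w) * φ (fourier γ n a))
    (((φ.comp (fourier γ n)).continuous.comp_continuousOn hc).sub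
      (Continuous.continuousOn (by fun_prop)))
    (((φ.comp (fourier γ n)).differentiable.comp_differentiableOn hd).sub
      (Differentiable.differentiableOn (by fun_prop)))
    (fun t => by
      rw [h0]
      change φ (fourier γ n (dualL γ t a)) - _ = 0
      rw [fourier_dualL, map_smul, smul_eq_mul, sub_self])
    (Set.right_mem_uIcc)
  rw [map_smul, smul_eq_mul]
  exact sub_eq_zero.1 key

end CrossedProduct

theorem ENNReal.ofReal_exp_mul_exp (s t : ℝ) :
    ENNReal.ofReal (Real.exp s) * ENNReal.ofReal (Real.exp t) =
      ENNReal.ofReal (Real.exp (s + t)) := by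
  rw [← ENNReal.ofReal_mul (Real.exp_nonneg _), Real.exp_add]

/-! ### General properties of weights. -/

namespace IsWeight

open Filter Topology
open scoped ENNReal NNReal

variable {A : Type*} [NonUnitalCStarAlgebra A] [PartialOrder A] [StarOrderedRing A]
  {ω : PosCone A → ℝ≥0∞}

lemma map_zero (hω : IsWeight ω) : ω ⟨0, le_rfl⟩ = 0 := by
  have h := hω.map_smul 0 ⟨0, le_rfl⟩
  rw [ENNReal.coe_zero, zero_mul] at h
  rw [← h]
  congr 2
  exact (smul_zero _).symm

lemma mono (hω : IsWeight ω) {a b : PosCone A} (hab : (a : A) ≤ b) : ω a ≤ ω b := by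
  have h := hω.map_add a ⟨b - a, sub_nonneg.2 hab⟩
  have h' : (⟨a + (b - a), add_nonneg a.2 (sub_nonneg.2 hab)⟩ : PosCone A) = b :=
    Subtype.ext (add_sub_cancel _ _)
  rw [h'] at h
  rw [h]
  exact le_self_add

lemma map_smul_of_eq (hω : IsWeight ω) {r : ℝ} (hr : 0 ≤ r) {a b : PosCone A}
    (h : (b : A) = r • (a : A)) : ω b = ENNReal.ofReal r * ω a := by
  have h1 := hω.map_smul r.toNNReal a
  rw [show b = ⟨(r.toNNReal : ℝ) • (a : A), smul_nonneg r.toNNReal.2 a.2⟩ from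
    Subtype.ext (h.trans (by change _ = (r.toNNReal : ℝ) • (a : A); rw [Real.coe_toNNReal _ hr])), h1]
  rfl

lemma map_sum (hω : IsWeight ω) {ι : Type*} (F : Finset ι) (a : ι → PosCone A) :
    ω ⟨∑ i ∈ F, (a i : A), Finset.sum_nonneg fun i _ => (a i).2⟩ = ∑ i ∈ F, ω (a i) := by
  classical
  induction F using Finset.induction_on with
  | empty => simpa using hω.map_zero
  | insert i F hi ih =>
    rw [Finset.sum_insert (f := fun i => ω (a i)) hi, ← ih, ← hω.map_add]
    exact congrArg ω (Subtype.ext (Finset.sum_insert hi))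

/-- A weight is countably additive with respect to unconditional norm convergence. -/
lemma map_hasSum (hω : IsWeight ω) {ι : Type*} {a : ι → PosCone A} {s : PosCone A}
    (h : HasSum (fun i => (a i : A)) s) : ω s = ∑' i, ω (a i) := by
  classical
  -- Lower semicontinuity along the net of partial sums gives `≤`, and monotonicity gives `≥`.
  refine le_antisymm (le_of_forall_lt fun c hc => ?_) ?_
  · let S : Finset ι → PosCone A :=
      fun F => ⟨∑ i ∈ F, (a i : A), Finset.sum_nonneg fun i _ => (a i).2⟩
    have hS : Tendsto S atTop (𝓝 s) := tendsto_subtype_rng.2 h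
    obtain ⟨F, hF⟩ := (hS.eventually (hω.lowerSemicontinuous s c hc)).exists
    rw [hω.map_sum] at hF
    exact hF.trans_le (ENNReal.sum_le_tsum F)
  · rw [ENNReal.tsum_eq_iSup_sum]
    refine iSup_le fun F => ?_
    rw [← hω.map_sum]
    exact hω.mono (sum_le_hasSum F (fun i _ => (a i).2) h)

/-- Writing `e = d* d` gives `e b e = d* (d b d*) d ≤ ‖d b d*‖ e`. No trace property is needed. -/
lemma conj_lt_top (hω : IsWeight ω) {e b : A} (he : 0 ≤ e) (hfin : ω ⟨e, he⟩ < ∞)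
    (hb : 0 ≤ b) (h : 0 ≤ e * b * e) : ω ⟨e * b * e, h⟩ < ∞ := by
  obtain ⟨d, hd⟩ := CStarAlgebra.nonneg_iff_eq_star_mul_self.1 he
  have hsa : IsSelfAdjoint (d * b * star d) := by
    rw [isSelfAdjoint_iff, star_mul, star_mul, star_star, (IsSelfAdjoint.of_nonneg hb).star_eq,
      mul_assoc]
  have h1 : e * b * e ≤ ‖d * b * star d‖ • e := by
    rw [hd]
    have := CStarAlgebra.star_left_conjugate_le_norm_smul (a := d) (b := d * b * star d) hsa
    simpa only [mul_assoc] using this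
  refine (hω.mono (a := ⟨e * b * e, h⟩)
    (b := ⟨‖d * b * star d‖ • e, smul_nonneg (norm_nonneg _) he⟩) h1).trans_lt ?_
  rw [hω.map_smul_of_eq (norm_nonneg _) (a := ⟨e, he⟩) rfl]
  exact ENNReal.mul_lt_top ENNReal.ofReal_lt_top hfin

lemma mul_self_lt_top (hω : IsWeight ω) {e : A} (he : 0 ≤ e) (hfin : ω ⟨e, he⟩ < ∞)
    (h : 0 ≤ e * e) : ω ⟨e * e, h⟩ < ∞ := by
  obtain ⟨d, hd⟩ := CStarAlgebra.nonneg_iff_eq_star_mul_self.1 he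
  have h1 : e * e ≤ ‖d * star d‖ • e := by
    rw [hd]
    simpa only [mul_assoc] using
      CStarAlgebra.star_left_conjugate_le_norm_smul (a := d) (.mul_star_self d)
  refine (hω.mono (a := ⟨e * e, h⟩)
    (b := ⟨‖d * star d‖ • e, smul_nonneg (norm_nonneg _) he⟩) h1).trans_lt ?_
  rw [hω.map_smul_of_eq (norm_nonneg _) (a := ⟨e, he⟩) rfl]
  exact ENNReal.mul_lt_top ENNReal.ofReal_lt_top hfin

end IsWeight

/-- With `b = d* d`, the trace property moves `e` inside: `τ(e d* d e) = τ(d e² d*) ≤ ‖e‖² τ(d d*) =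
‖e‖² τ(b)`. -/
lemma IsWeight.conj_le_of_tracial {A : Type*} [NonUnitalCStarAlgebra A] [PartialOrder A] [StarOrderedRing A]
    {τ : PosCone A → ENNReal} (hτ : IsWeight τ)
    (htr : ∀ a : A, τ ⟨star a * a, star_mul_self_nonneg a⟩ = τ ⟨a * star a, mul_star_self_nonneg a⟩)
    {e b : A} (he : 0 ≤ e) (hb : 0 ≤ b) (h : 0 ≤ e * b * e) :
    τ ⟨e * b * e, h⟩ ≤ ENNReal.ofReal (‖e‖ ^ 2) * τ ⟨b, hb⟩ := by
  obtain ⟨d, rfl⟩ := CStarAlgebra.nonneg_iff_eq_star_mul_self.1 hb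
  have hes : star e = e := (IsSelfAdjoint.of_nonneg he).star_eq
  have h1 : τ ⟨e * (star d * d) * e, h⟩ = τ ⟨d * (e * e) * star d, by
      have := mul_star_self_nonneg (d * e)
      rwa [star_mul, hes, ← mul_assoc, mul_assoc d] at this⟩ := by
    convert htr (d * e) using 3
    · rw [star_mul, hes]; simp only [mul_assoc]
    · rw [star_mul, hes]; simp only [mul_assoc]
  rw [h1, htr d, ← hτ.map_smul_of_eq (by positivity) (a := ⟨d * star d, mul_star_self_nonneg d⟩)
    (b := ⟨‖e‖ ^ 2 • (d * star d), smul_nonneg (by positivity) (mul_star_self_nonneg d)⟩) rfl]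
  refine hτ.mono ?_
  have h2 := CStarAlgebra.star_right_conjugate_le_norm_smul (a := d) (b := e * e)
    (by rw [isSelfAdjoint_iff, star_mul, hes])
  have h3 : ‖e * e‖ = ‖e‖ ^ 2 := by
    rw [sq, ← CStarRing.norm_star_mul_self, hes]
  rwa [h3] at h2

/-! ### Averages under a KMS weight, and compression by elements of `B`. -/

namespace CrossedProduct

open Filter Topology
open scoped ENNReal NNReal

lemma weight_average {B : Type*} [NonUnitalCStarAlgebra B] {γ : B ≃⋆ₐ[ℂ] B} {β : ℝ}
    {ω : PosCone (CrossedProduct γ) → ℝ≥0∞} (hω : IsKMSWeight (dualFlow γ) β ω) (N : ℕ) {x : CrossedProduct γ}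
    (hx : 0 ≤ x) : ω ⟨average γ N x, average_nonneg N hx⟩ = ω ⟨x, hx⟩ := by
  let y : ℕ → PosCone (CrossedProduct γ) := fun k =>
    ⟨dualAut γ (2 * Real.pi * k / (N + 1)) x, map_nonneg (dualAut γ _) hx⟩
  have hy : ∀ k, ω (y k) = ω ⟨x, hx⟩ := fun k => hω.invariant _ ⟨x, hx⟩
  have h := hω.toIsWeight.map_smul_of_eq (r := (N + 1 : ℝ)⁻¹) (by positivity)
    (a := ⟨∑ k ∈ Finset.range (N + 1), (y k : CrossedProduct γ),
      Finset.sum_nonneg fun k _ => (y k).2⟩)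
    (b := ⟨average γ N x, average_nonneg N hx⟩) (average_apply N x)
  rw [h, hω.toIsWeight.map_sum]
  simp only [hy, Finset.sum_const, Finset.card_range, nsmul_eq_mul]
  rw [← mul_assoc, ← ENNReal.ofReal_natCast, ← ENNReal.ofReal_mul (by positivity)]
  push_cast
  rw [inv_mul_cancel₀ (by positivity), ENNReal.ofReal_one, one_mul]

variable {B : Type*} [NonUnitalCStarAlgebra B] [PartialOrder B] [StarOrderedRing B]
  {γ : B ≃⋆ₐ[ℂ] B}

/-- An approximate unit of `B` acts as one on the crossed product. -/
lemma tendsto_embed_mul (x : CrossedProduct γ) :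
    Tendsto (fun u => embed γ u * x) (CStarAlgebra.approximateUnit B) (𝓝 x) := by
  have hu := CStarAlgebra.increasingApproximateUnit B
  have hf : ∀ f : TwistedCc γ,
      Tendsto (fun u => embed γ u * of f) (CStarAlgebra.approximateUnit B) (𝓝 (of f)) := by
    intro f
    induction f using TwistedCc.induction_single with
    | zero => simp
    | add f g hf hg => simp only [map_add, mul_add]; exact hf.add hg
    | single n b =>
      have h1 : ∀ u, embed γ u * of (TwistedCc.single n b) = of (TwistedCc.single n (u * b)) := by
        intro u
        rw [embed_apply, ← of_mul, TwistedCc.single_mul_single, zero_add]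
        rfl
      simp only [h1]
      have hc : Continuous fun b : B => (of (TwistedCc.single n b) : CrossedProduct γ) := by
        refine AddMonoidHomClass.continuous_of_bound
          ((of (γ := γ)).toLinearMap.toAddMonoidHom.comp (TwistedCc.singleHom n)) 1 fun b => ?_
        rw [one_mul]
        change ‖of (TwistedCc.single n b)‖ ≤ _
        rw [norm_of]
        exact TwistedCc.norm_single_le n b
      exact (hc.tendsto b).comp (hu.tendsto_mul_right b)
  refine Metric.tendsto_nhds.2 fun ε hε => ?_
  obtain ⟨f, hfx⟩ := denseRange_of.exists_dist_lt x (show 0 < ε / 3 by positivity)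
  filter_upwards [hu.eventually_norm,
    Metric.tendsto_nhds.1 (hf f) (ε / 3) (by positivity)] with u hu1 hu2
  rw [dist_eq_norm] at hfx hu2 ⊢
  have h1 : embed γ u * x - x = embed γ u * (x - of f) + (embed γ u * of f - of f) -
      (x - of f) := by rw [mul_sub]; abel
  have h2 : ‖embed γ u * (x - of f)‖ ≤ ‖x - of f‖ :=
    (norm_mul_le _ _).trans
      (mul_le_of_le_one_left (norm_nonneg _) ((norm_embed_le u).trans hu1))
  rw [h1]
  have h5 := norm_sub_le (embed γ u * (x - of f) + (embed γ u * of f - of f)) (x - of f)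
  have h6 := norm_add_le (embed γ u * (x - of f)) (embed γ u * of f - of f)
  linarith

lemma tendsto_embed_conj (x : CrossedProduct γ) :
    Tendsto (fun u => embed γ u * x * embed γ u) (CStarAlgebra.approximateUnit B) (𝓝 x) := by
  have hu := CStarAlgebra.increasingApproximateUnit B
  have hr : Tendsto (fun u => x * embed γ u) (CStarAlgebra.approximateUnit B) (𝓝 x) := by
    have := (continuous_star.tendsto _).comp (tendsto_embed_mul (star x))
    rw [star_star] at this
    refine this.congr' ?_
    filter_upwards [hu.eventually_star_eq] with u hu1
    rw [Function.comp_apply, star_mul, star_star, ← map_star, hu1]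
  refine Metric.tendsto_nhds.2 fun ε hε => ?_
  filter_upwards [hu.eventually_norm, Metric.tendsto_nhds.1 hr (ε / 2) (by positivity),
    Metric.tendsto_nhds.1 (tendsto_embed_mul x) (ε / 2) (by positivity)] with u hu1 hu2 hu3
  rw [dist_eq_norm] at hu2 hu3 ⊢
  have h1 : embed γ u * x * embed γ u - x =
      embed γ u * (x * embed γ u - x) + (embed γ u * x - x) := by
    rw [mul_sub, mul_assoc]; abel
  have h2 : ‖embed γ u * (x * embed γ u - x)‖ ≤ ‖x * embed γ u - x‖ :=
    (norm_mul_le _ _).trans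
      (mul_le_of_le_one_left (norm_nonneg _) ((norm_embed_le u).trans hu1))
  rw [h1]
  have := norm_add_le (embed γ u * (x * embed γ u - x)) (embed γ u * x - x)
  linarith

/-- An element of the approximate unit satisfies both norm conditions, which are open in the
positive cone, so a nearby element of finite weight does too. The perturbation is why the norm is
bounded by `1 + ε` and not by `1`. Only density is assumed, so the result applies before the
restriction is known to be a weight. -/
lemma exists_finite_conj_near {τ : PosCone B → ℝ≥0∞} (hτ : Dense {a : PosCone B | τ a < ∞})
    (x : CrossedProduct γ) {ε : ℝ} (hε : 0 < ε) :
    ∃ e : PosCone B, τ e < ∞ ∧ ‖(e : B)‖ < 1 + ε ∧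
      ‖embed γ e * x * embed γ e - x‖ < ε := by
  have hu := CStarAlgebra.increasingApproximateUnit B
  obtain ⟨u, hu0, hu1, hu2⟩ := (hu.eventually_nonneg.and (hu.eventually_norm.and
    (Metric.tendsto_nhds.1 (tendsto_embed_conj x) ε hε))).exists
  rw [dist_eq_norm] at hu2
  have hce : Continuous fun e : PosCone B => embed γ (e : B) :=
    continuous_embed.comp continuous_subtype_val
  have hO : IsOpen {e : PosCone B | ‖(e : B)‖ < 1 + ε ∧
      ‖embed γ (e : B) * x * embed γ (e : B) - x‖ < ε} := by
    refine IsOpen.inter (isOpen_lt (continuous_subtype_val.norm) continuous_const) ?_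
    exact isOpen_lt ((((hce.mul continuous_const).mul hce).sub continuous_const).norm)
      continuous_const
  obtain ⟨e, he, he'⟩ := hτ.inter_open_nonempty _ hO ⟨⟨u, hu0⟩, by
    change ‖u‖ < 1 + ε; linarith, hu2⟩
  exact ⟨e, he', he.1, he.2⟩

lemma embed_conj_nonneg {e : B} (he : 0 ≤ e) {x : CrossedProduct γ} (hx : 0 ≤ x) :
    0 ≤ embed γ e * x * embed γ e := by
  have h := star_left_conjugate_nonneg hx (embed γ e)
  rwa [← map_star, (IsSelfAdjoint.of_nonneg he).star_eq] at h

lemma conj_nonneg {e : B} (he : 0 ≤ e) {x : B} (hx : 0 ≤ x) :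
    0 ≤ e * x * e := by
  have h := star_left_conjugate_nonneg hx e
  rwa [(IsSelfAdjoint.of_nonneg he).star_eq] at h

/-! ### From KMS weights to traces. -/

section KMS

variable {β : ℝ} {ω : PosCone (CrossedProduct γ) → ℝ≥0∞}

/-- The averages of `x` have weight `ω(x)` by invariance and converge to `P(x)`, so lower
semicontinuity applies. -/
lemma weight_embed_expectation_le (hω : IsKMSWeight (dualFlow γ) β ω) {x : CrossedProduct γ}
    (hx : 0 ≤ x) : compExpectation γ (restrictWeight γ ω) ⟨x, hx⟩ ≤ ω ⟨x, hx⟩ := by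
  refine le_of_forall_lt fun c hc => ?_
  have ht : Tendsto (fun N => (⟨average γ N x, average_nonneg N hx⟩ : PosCone (CrossedProduct γ)))
      atTop (𝓝 ⟨embed γ (expectation γ x), map_nonneg (embed γ) (expectation_nonneg hx)⟩) :=
    tendsto_subtype_rng.2 (tendsto_average x)
  obtain ⟨N, hN⟩ := (ht.eventually (hω.lowerSemicontinuous _ c hc)).exists
  rwa [weight_average hω] at hN

/-- The expectation is continuous and onto, so it carries the dense set where `ω` is finite to a
dense set, on which the restriction is finite by `weight_embed_expectation_le`. -/
lemma restrictWeight_dense (hω : IsKMSWeight (dualFlow γ) β ω) :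
    Dense {b : PosCone B | restrictWeight γ ω b < ∞} := by
  let p : PosCone (CrossedProduct γ) → PosCone B :=
    fun x => ⟨expectation γ x, expectation_nonneg x.2⟩
  have hp : Continuous p :=
    ((expectation γ).continuous.comp continuous_subtype_val).subtype_mk _
  have hs : Function.Surjective p := fun b =>
    ⟨⟨embed γ b, map_nonneg (embed γ) b.2⟩, Subtype.ext (expectation_embed _)⟩
  refine (hs.denseRange.dense_image hp hω.denselyDefined).mono ?_
  rintro _ ⟨x, hx, rfl⟩
  exact (weight_embed_expectation_le hω x.2).trans_lt hx

/-- Elements of `B` are fixed by the dual action, so the KMS condition on them is the trace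
property. -/
lemma restrictWeight_tracial (hω : IsKMSWeight (dualFlow γ) β ω) (a : B) :
    restrictWeight γ ω ⟨star a * a, star_mul_self_nonneg a⟩ =
      restrictWeight γ ω ⟨a * star a, mul_star_self_nonneg a⟩ := by
  have h := hω.kms _ _ (hasExtension_single 0 a _)
  simp only [Int.cast_zero, mul_zero, zero_mul, Complex.exp_zero, one_smul] at h
  have h1 : ∀ c d : B, embed γ (c * d) = embed γ c * embed γ d := map_mul (embed γ)
  have h2 : embed γ (star a) = star (embed γ a) := map_star (embed γ) a
  exact (congrArg ω (Subtype.ext (by simp only [h1, h2]; rfl))).trans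
    (h.trans (congrArg ω (Subtype.ext (by simp only [h1, h2]; rfl))))

/-- A KMS weight is determined on `e x e` by the expectation, up to the required inequality, as long
as its value at `e` is finite. -/
lemma weight_conj_le (hω : IsKMSWeight (dualFlow γ) β ω) {x : CrossedProduct γ} (hx : 0 ≤ x)
    {e : B} (he : 0 ≤ e) (hfin : restrictWeight γ ω ⟨e, he⟩ < ∞) :
    ω ⟨embed γ e * x * embed γ e, embed_conj_nonneg he hx⟩ ≤
      restrictWeight γ ω ⟨e * expectation γ x * e, conj_nonneg he (expectation_nonneg hx)⟩ := by
  set E := embed γ e with hE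
  have hE0 : 0 ≤ E := map_nonneg (embed γ) he
  have hEs : star E = E := (IsSelfAdjoint.of_nonneg hE0).star_eq
  set p := embed γ (expectation γ x) with hp
  have hp0 : 0 ≤ p := map_nonneg (embed γ) (expectation_nonneg hx)
  have hEE : 0 ≤ E * E := by have := star_mul_self_nonneg E; rwa [hEs] at this
  have hM : ω ⟨E * E, hEE⟩ < ∞ := hω.toIsWeight.mul_self_lt_top hE0 hfin hEE
  have hpe : restrictWeight γ ω ⟨e * expectation γ x * e, conj_nonneg he (expectation_nonneg hx)⟩ =
      ω ⟨E * p * E, embed_conj_nonneg he hp0⟩ := by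
    unfold restrictWeight
    congr 2
    rw [map_mul, map_mul]
  rw [hpe]
  -- Conjugation by `E` commutes with averaging, and `E y E ≤ ‖y‖ E²` for the self-adjoint error `y`
  -- between the average and `p`. Since `ω(E²)` is finite, the error term tends to zero.
  have bound : ∀ N : ℕ, ω ⟨E * x * E, embed_conj_nonneg he hx⟩ ≤
      ω ⟨E * p * E, embed_conj_nonneg he hp0⟩ +
        ENNReal.ofReal ‖average γ N x - p‖ * ω ⟨E * E, hEE⟩ := by
    intro N
    have hav : average γ N (E * x * E) = E * average γ N x * E := by
      simp only [average_apply]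
      rw [mul_smul_comm, smul_mul_assoc, Finset.mul_sum, Finset.sum_mul]
      congr 1
      refine Finset.sum_congr rfl fun k _ => ?_
      rw [← dualAut_apply, map_mul, map_mul, dualAut_apply, hE, dualL_embed, dualAut_apply]
    rw [← weight_average hω N (embed_conj_nonneg he hx),
      ← hω.toIsWeight.map_smul_of_eq (norm_nonneg _) (a := ⟨E * E, hEE⟩)
        (b := ⟨‖average γ N x - p‖ • (E * E), smul_nonneg (norm_nonneg _) hEE⟩) rfl,
      ← hω.map_add]
    refine hω.toIsWeight.mono ?_
    change average γ N (E * x * E) ≤ E * p * E + ‖average γ N x - p‖ • (E * E)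
    rw [hav]
    have h := CStarAlgebra.star_left_conjugate_le_norm_smul (a := E) (b := average γ N x - p)
      ((IsSelfAdjoint.of_nonneg (average_nonneg N hx)).sub (IsSelfAdjoint.of_nonneg hp0))
    rw [hEs, mul_sub, sub_mul, sub_le_iff_le_add] at h
    rwa [add_comm]
  have hlim : Tendsto (fun N => ω ⟨E * p * E, embed_conj_nonneg he hp0⟩ +
      ENNReal.ofReal ‖average γ N x - p‖ * ω ⟨E * E, hEE⟩) atTop
      (𝓝 (ω ⟨E * p * E, embed_conj_nonneg he hp0⟩ + 0)) := by
    refine Tendsto.add tendsto_const_nhds ?_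
    have h0 : Tendsto (fun N => ENNReal.ofReal ‖average γ N x - p‖) atTop (𝓝 0) := by
      have := ((tendsto_average x).sub_const p).norm
      rw [sub_self, norm_zero] at this
      simpa using ENNReal.tendsto_ofReal this
    have := ENNReal.Tendsto.mul_const h0 (b := ω ⟨E * E, hEE⟩) (.inr hM.ne)
    rwa [zero_mul] at this
  rw [add_zero] at hlim
  exact ge_of_tendsto' hlim bound

lemma restrictWeight_lowerSemicontinuous (hω : IsWeight ω) :
    LowerSemicontinuous (restrictWeight γ ω) :=
  hω.lowerSemicontinuous.comp
    ((continuous_embed.comp continuous_subtype_val).subtype_mk _)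

lemma restrictWeight_add (hω : IsWeight ω) (a b : PosCone B) :
    restrictWeight γ ω ⟨a + b, add_nonneg a.2 b.2⟩ =
      restrictWeight γ ω a + restrictWeight γ ω b := by
  unfold restrictWeight
  rw [← hω.map_add]
  congr 2
  exact map_add (embed γ) _ _

lemma embed_real_smul (r : ℝ) (b : B) : embed γ (r • b) = r • embed γ b := by
  rw [← Complex.coe_smul, ← Complex.coe_smul, map_smul]

lemma restrictWeight_smul (hω : IsWeight ω) (r : ℝ≥0) (a : PosCone B) :
    restrictWeight γ ω ⟨(r : ℝ) • (a : B), smul_nonneg r.2 a.2⟩ =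
      r * restrictWeight γ ω a := by
  unfold restrictWeight
  rw [← hω.map_smul]
  congr 2
  exact embed_real_smul _ _

/-- A KMS weight for the dual action factors through the conditional expectation. -/
lemma compExpectation_restrictWeight (hω : IsKMSWeight (dualFlow γ) β ω) :
    compExpectation γ (restrictWeight γ ω) = ω := by
  funext ⟨x, hx⟩
  refine le_antisymm (weight_embed_expectation_le hω hx) ?_
  have hdense := restrictWeight_dense hω
  -- A weight must be non-zero, so the restriction cannot be treated as one until this is settled.
  -- If it vanished, `ω` would be zero on all compressions `e x e` with `e` of finite weight, and
  -- lower semicontinuity would force `ω(x) = 0`.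
  by_cases hz : ∃ b, restrictWeight γ ω b ≠ 0
  swap
  · push Not at hz
    refine le_of_forall_lt fun c hc => ?_
    have hl := hω.lowerSemicontinuous ⟨x, hx⟩ c hc
    obtain ⟨ε, hε, hl⟩ := Metric.eventually_nhds_iff.1 hl
    obtain ⟨⟨e, he⟩, hef, -, hex⟩ := exists_finite_conj_near hdense x hε
    have := hl (y := ⟨_, embed_conj_nonneg he hx⟩) (by rw [Subtype.dist_eq, dist_eq_norm]; exact hex)
    have h2 := this.trans_le (weight_conj_le hω hx he hef)
    rw [hz] at h2
    exact absurd h2 (not_lt.2 zero_le)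
  have hτ : IsWeight (restrictWeight γ ω) :=
    ⟨restrictWeight_add hω.toIsWeight, restrictWeight_smul hω.toIsWeight, hz, hdense,
      restrictWeight_lowerSemicontinuous hω.toIsWeight⟩
  set T := compExpectation γ (restrictWeight γ ω) ⟨x, hx⟩ with hT
  -- Lower semicontinuity keeps the weight of `e x e` above `c` for `e x e` near `x`. The factor
  -- bounds `‖e‖²` and disappears as `δ → 0`.
  have bound : ∀ c < ω ⟨x, hx⟩, ∀ δ : ℝ, 0 < δ → c ≤ ENNReal.ofReal ((1 + δ) ^ 2) * T := by
    intro c hc δ hδ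
    have hl := hω.lowerSemicontinuous ⟨x, hx⟩ c hc
    obtain ⟨ε, hε, hl⟩ := Metric.eventually_nhds_iff.1 hl
    obtain ⟨⟨e, he⟩, hef, hen, hex⟩ := exists_finite_conj_near hdense x (lt_min hε hδ)
    have h1 := hl (y := ⟨_, embed_conj_nonneg he hx⟩)
      (by rw [Subtype.dist_eq, dist_eq_norm]; exact hex.trans_le (min_le_left _ _))
    refine (h1.trans_le (weight_conj_le hω hx he hef)).le.trans ?_
    refine (IsWeight.conj_le_of_tracial hτ (restrictWeight_tracial hω) he (expectation_nonneg hx) _).trans ?_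
    refine mul_le_mul' (ENNReal.ofReal_le_ofReal ?_) le_rfl
    have : ‖e‖ ≤ 1 + δ := hen.le.trans (by linarith [min_le_right ε δ])
    gcongr
  refine le_of_forall_lt_imp_le_of_dense fun c hc => ?_
  rcases eq_or_ne T ∞ with hTt | hTt
  · rw [hTt]; exact le_top
  have hlim : Tendsto (fun δ : ℝ => ENNReal.ofReal ((1 + δ) ^ 2) * T) (𝓝[>] 0) (𝓝 T) := by
    have h1 : Continuous fun δ : ℝ => ENNReal.ofReal ((1 + δ) ^ 2) :=
      ENNReal.continuous_ofReal.comp (by fun_prop)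
    have h2 := ENNReal.Tendsto.mul_const ((h1.tendsto 0).mono_left (nhdsWithin_le_nhds (s := Set.Ioi 0)))
      (b := T) (.inr hTt)
    simpa using h2
  refine ge_of_tendsto hlim ?_
  filter_upwards [self_mem_nhdsWithin] with δ hδ
  exact bound c hc δ hδ

lemma restrictWeight_scaling (hω : IsKMSWeight (dualFlow γ) β ω) (b : PosCone B) :
    restrictWeight γ ω ⟨γ b, map_nonneg γ b.2⟩ =
      ENNReal.ofReal (Real.exp (-β)) * restrictWeight γ ω b := by
  obtain ⟨b, hb⟩ := b
  obtain ⟨d, rfl⟩ := CStarAlgebra.nonneg_iff_eq_star_mul_self.1 hb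
  -- For `a = γ(d) u` one has `a* a = d* d`, `a a* = γ(d) γ(d)*` and `θ_{-iβ/2}(a) = e^{β/2} a`. The
  -- KMS condition is then the scaling relation, up to the trace property on `B`.
  have h := hω.kms _ _ (hasExtension_single 1 (γ d) (-(Complex.I * β / 2)))
  have hexp : Complex.exp (Complex.I * (1 : ℤ) * -(Complex.I * β / 2)) =
      ((Real.exp (β / 2) : ℝ) : ℂ) := by
    push_cast
    congr 1
    linear_combination (-(β : ℂ) / 2) * Complex.I_sq
  have hγ : (γ ^ (-1 : ℤ)) (star (γ d) * γ d) = star d * d := by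
    rw [← map_star, ← map_mul]
    change γ.symm (γ _) = _
    exact γ.symm_apply_apply _
  have h1 : restrictWeight γ ω ⟨star d * d, hb⟩ =
      ω ⟨_, star_mul_self_nonneg (of (TwistedCc.single 1 (γ d)))⟩ := by
    unfold restrictWeight
    congr 2
    change embed γ (star d * d) = _
    rw [← of_star, ← of_mul, TwistedCc.star_single, TwistedCc.single_mul_single, ← map_mul,
      hγ, embed_apply]
    simp
  have h2 : ω ⟨_, mul_star_self_nonneg (Complex.exp (Complex.I * (1 : ℤ) * -(Complex.I * β / 2)) •
      of (TwistedCc.single 1 (γ d)))⟩ =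
      ENNReal.ofReal (Real.exp β) * restrictWeight γ ω ⟨γ d * star (γ d), mul_star_self_nonneg _⟩ := by
    refine hω.toIsWeight.map_smul_of_eq (Real.exp_nonneg β) ?_
    change Complex.exp (Complex.I * (1 : ℤ) * -(Complex.I * β / 2)) •
      of (TwistedCc.single 1 (γ d)) * star (Complex.exp (Complex.I * (1 : ℤ) *
        -(Complex.I * β / 2)) • of (TwistedCc.single 1 (γ d))) =
      Real.exp β • embed γ (γ d * star (γ d))
    rw [hexp, star_smul, smul_mul_smul_comm, ← of_star, ← of_mul, TwistedCc.star_single,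
      TwistedCc.single_mul_single, TwistedCc.zpow_apply_zpow, embed_apply, ← Complex.coe_smul]
    congr 1
    · rw [Complex.star_def, Complex.conj_ofReal, ← Complex.ofReal_mul, ← Real.exp_add, add_halves]
  rw [h1, h, h2, ← mul_assoc, ENNReal.ofReal_exp_mul_exp, neg_add_cancel, Real.exp_zero,
    ENNReal.ofReal_one, one_mul, ← restrictWeight_tracial hω]
  congr 2
  simp [map_mul, map_star]

lemma isTrace_restrictWeight (hω : IsKMSWeight (dualFlow γ) β ω) :
    IsTrace (restrictWeight γ ω) where
  map_add := restrictWeight_add hω.toIsWeight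
  map_smul := restrictWeight_smul hω.toIsWeight
  ne_zero := by
    obtain ⟨x, hx⟩ := hω.ne_zero
    -- The factorization through the expectation turns a point where `ω` is non-zero into one in
    -- `B₊`.
    rw [← compExpectation_restrictWeight hω] at hx
    exact ⟨_, hx⟩
  denselyDefined := restrictWeight_dense hω
  lowerSemicontinuous := restrictWeight_lowerSemicontinuous hω.toIsWeight
  tracial := restrictWeight_tracial hω

end KMS

/-! ### From traces to KMS weights. -/

section Trace

variable {β : ℝ} {τ : PosCone B → ℝ≥0∞}

lemma restrictWeight_compExpectation (τ : PosCone B → ℝ≥0∞) :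
    restrictWeight γ (compExpectation γ τ) = τ :=
  funext fun b => congrArg τ (Subtype.ext (expectation_embed (b : B)))

lemma isWeight_compExpectation (hτ : IsWeight τ) : IsWeight (compExpectation γ τ) where
  map_add a b := by
    unfold compExpectation
    rw [← hτ.map_add]
    congr 2
    exact map_add (expectation γ) _ _
  map_smul r a := by
    unfold compExpectation
    rw [← hτ.map_smul]
    congr 2
    change expectation γ ((r : ℝ) • (a : CrossedProduct γ)) = (r : ℝ) • expectation γ a
    rw [← Complex.coe_smul, ← Complex.coe_smul, map_smul]
  ne_zero := by
    obtain ⟨b, hb⟩ := hτ.ne_zero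
    rw [← restrictWeight_compExpectation (γ := γ) τ] at hb
    exact ⟨_, hb⟩
  denselyDefined := by
    refine Metric.dense_iff.2 fun x ε hε => ?_
    -- The compressions `e x e` are dense and have finite weight, because `P(e x e) = e P(x) e` and
    -- `τ(e) < ∞`.
    obtain ⟨⟨e, he⟩, hef, -, hex⟩ := exists_finite_conj_near hτ.denselyDefined (x : CrossedProduct γ) hε
    refine ⟨⟨_, embed_conj_nonneg he x.2⟩, ?_, ?_⟩
    · rw [Metric.mem_ball, Subtype.dist_eq, dist_eq_norm]; exact hex
    · have h := hτ.conj_lt_top he hef (expectation_nonneg x.2)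
        (conj_nonneg he (expectation_nonneg x.2))
      exact (congrArg τ (Subtype.ext
        (expectation_embed_mul_mul_embed (x : CrossedProduct γ) e e))).trans_lt h
  lowerSemicontinuous := hτ.lowerSemicontinuous.comp
    (((expectation γ).continuous.comp continuous_subtype_val).subtype_mk _)

lemma compExpectation_mul_star (hτ : IsWeight τ) (x : CrossedProduct γ) :
    compExpectation γ τ ⟨x * star x, mul_star_self_nonneg x⟩ =
      ∑' n, τ ⟨fourier γ n x * star (fourier γ n x), mul_star_self_nonneg _⟩ :=
  hτ.map_hasSum (a := fun n => ⟨fourier γ n x * star (fourier γ n x), mul_star_self_nonneg _⟩)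
    (hasSum_fourier x)

lemma zpow_scaling (hs : ∀ b : PosCone B,
      τ ⟨γ b, map_nonneg γ b.2⟩ = ENNReal.ofReal (Real.exp (-β)) * τ b) (n : ℤ) (b : PosCone B) :
    τ ⟨(γ ^ n) b, map_nonneg (γ ^ n) b.2⟩ = ENNReal.ofReal (Real.exp (-(n * β))) * τ b := by
  induction n with
  | zero => simp
  | succ n ih =>
    have h := hs ⟨(γ ^ (n : ℤ)) b, map_nonneg (γ ^ (n : ℤ)) b.2⟩
    rw [ih, ← mul_assoc, ENNReal.ofReal_exp_mul_exp] at h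
    convert h using 3
    · rw [add_comm, zpow_add, zpow_one]; rfl
    · push_cast; ring_nf
  | pred n ih =>
    have h := hs ⟨(γ ^ (-(n : ℤ) - 1)) b, map_nonneg (γ ^ (-(n : ℤ) - 1)) b.2⟩
    have h' : (⟨γ ((γ ^ (-(n : ℤ) - 1)) b), map_nonneg γ (map_nonneg (γ ^ (-(n : ℤ) - 1)) b.2)⟩ :
        PosCone B) = ⟨(γ ^ (-(n : ℤ))) b, map_nonneg (γ ^ (-(n : ℤ))) b.2⟩ := by
      refine Subtype.ext ?_
      have hz : γ * γ ^ (-(n : ℤ) - 1) = γ ^ (-(n : ℤ)) := by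
        rw [← zpow_one_add]; congr 1; ring
      exact DFunLike.congr_fun hz (b : B)
    rw [h', ih] at h
    -- The downward step inverts the scaling by multiplying with `e^β`, which is legitimate even
    -- where `τ` is infinite.
    have h2 := congrArg (ENNReal.ofReal (Real.exp β) * ·) h
    simp only [← mul_assoc, ENNReal.ofReal_exp_mul_exp, add_neg_cancel, Real.exp_zero,
      ENNReal.ofReal_one, one_mul] at h2
    rw [← h2]
    congr 3
    push_cast; ring

lemma isKMSWeight_compExpectation (hτ : IsTrace τ) (hs : ∀ b : PosCone B,
      τ ⟨γ b, map_nonneg γ b.2⟩ = ENNReal.ofReal (Real.exp (-β)) * τ b) :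
    IsKMSWeight (dualFlow γ) β (compExpectation γ τ) where
  toIsWeight := isWeight_compExpectation hτ.toIsWeight
  invariant t a := congrArg τ (Subtype.ext (expectation_dualL t (a : CrossedProduct γ)))
  kms a b h := by
    have h1 : compExpectation γ τ ⟨star a * a, star_mul_self_nonneg a⟩ =
        compExpectation γ τ ⟨star a * star (star a), mul_star_self_nonneg (star a)⟩ := by
      congr 2; rw [star_star]
    -- Parseval is applied to `a*` and to `b`. The first sum is reindexed by `n ↦ -n`, because the
    -- coefficient of `a*` at `-n` is built from that of `a` at `n`.
    rw [h1, compExpectation_mul_star hτ.toIsWeight, compExpectation_mul_star hτ.toIsWeight,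
      ← (Equiv.neg ℤ).tsum_eq]
    refine tsum_congr fun n => ?_
    set c := fourier γ n a with hc
    have h2 : τ ⟨_, mul_star_self_nonneg (fourier γ (Equiv.neg ℤ n) (star a))⟩ =
        ENNReal.ofReal (Real.exp (n * β)) * τ ⟨c * star c, mul_star_self_nonneg c⟩ := by
      have h3 := zpow_scaling hs (-n) ⟨star c * c, star_mul_self_nonneg c⟩
      rw [hτ.tracial] at h3
      convert h3 using 3
      · rw [Equiv.neg_apply, fourier_star, neg_neg, ← hc, ← map_star (γ ^ (-n)), star_star,
          ← map_mul (γ ^ (-n))]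
      · push_cast; ring_nf
    rw [h2]
    refine (hτ.toIsWeight.map_smul_of_eq (Real.exp_nonneg _) ?_).symm
    change fourier γ n b * star (fourier γ n b) = Real.exp (n * β) • (c * star c)
    have hexp : Complex.exp (Complex.I * n * -(Complex.I * β / 2)) =
        ((Real.exp (n * β / 2) : ℝ) : ℂ) := by
      push_cast
      congr 1
      linear_combination (-(n * β : ℂ) / 2) * Complex.I_sq
    rw [fourier_hasExtension h, hexp, star_smul, smul_mul_smul_comm, ← Complex.coe_smul]
    congr 1
    rw [Complex.star_def, Complex.conj_ofReal, ← Complex.ofReal_mul, ← Real.exp_add, add_halves]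

end Trace

end CrossedProduct

theorem lemma3p1 {B : Type*} [NonUnitalCStarAlgebra B] [PartialOrder B] [StarOrderedRing B]
    [TopologicalSpace.SeparableSpace B] (γ : B ≃⋆ₐ[ℂ] B) (β : ℝ) :
    Set.BijOn (restrictWeight γ)
      {ω | IsKMSWeight (CrossedProduct.dualFlow γ) β ω}
      {τ | IsTrace τ ∧ ∀ b : PosCone B,
        τ ⟨γ b, map_nonneg γ b.2⟩ = ENNReal.ofReal (Real.exp (-β)) * τ b} ∧
    Set.InvOn (compExpectation γ) (restrictWeight γ)
      {ω | IsKMSWeight (CrossedProduct.dualFlow γ) β ω}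
      {τ | IsTrace τ ∧ ∀ b : PosCone B,
        τ ⟨γ b, map_nonneg γ b.2⟩ = ENNReal.ofReal (Real.exp (-β)) * τ b} := by
  have hinv : Set.InvOn (compExpectation γ) (restrictWeight γ)
      {ω | IsKMSWeight (CrossedProduct.dualFlow γ) β ω}
      {τ | IsTrace τ ∧ ∀ b : PosCone B,
        τ ⟨γ b, map_nonneg γ b.2⟩ = ENNReal.ofReal (Real.exp (-β)) * τ b} :=
    ⟨fun _ hω => CrossedProduct.compExpectation_restrictWeight hω,
      fun τ _ => CrossedProduct.restrictWeight_compExpectation τ⟩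
  exact ⟨hinv.bijOn
    (fun _ hω => ⟨CrossedProduct.isTrace_restrictWeight hω,
      CrossedProduct.restrictWeight_scaling hω⟩)
    (fun _ hτ => CrossedProduct.isKMSWeight_compExpectation hτ.1 hτ.2), hinv⟩
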